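/- Let $\eta(\tau)=q^{1/24}\prod_{n\ge 1}(1-q^n)$, $q=e^{2\pi i\tau}$, be the Dedekind eta function on the upper half plane. The function $f_{32}(\tau)=\eta(4\tau)^2\eta(8\tau)^2=\sum_{n\ge1}a_nq^n$ is a cusp form of weight $2$ for $\Gamma_0(32)$. Let $L(f_{32},s)$ be its $L$-function, i.e. the entire continuation of the Dirichlet series $\sum_{n\ge 1}a_nn^{-s}$, which converges for $\operatorname{Re}(s)>2$. Let $B(a,b)=\int_0^1x^{a-1}(1-x)^{b-1}\,dx$ be the beta function. For an imaginary quadratic field $K$ of discriminant $-d$, with class number $h_K$ and exactly $n$ roots of unity, and with attached quadratic Dirichlet character $\epsilon$ modulo $d$, put $$b_K=\Gamma\left(\tfrac12\right)\prod_{0<a<d}\Gamma\left(\tfrac ad\right)^{\frac{n\epsilon(a)}{4h_K}}.$$ Then $$L(f_{32},1)=L\left(\eta(4\tau)^2\eta(8\tau)^2,1\right)=2^{-7/2}B\left(\tfrac14,\tfrac14\right)=\tfrac18\,b_{\mathbb Q(\sqrt{-4})}.$$ -/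

import Mathlib

open scoped IntermediateField

/-- The Kronecker symbol `(D / a)` for a positive integer `a`. Writing `a = 2 ^ v * m` with `m` odd,
it is `(D / 2) ^ v` times the Jacobi symbol `(D / m)`, where `(D / 2)` is `0` if `D` is even, `1` if
`D` is `1` or `7` modulo `8`, and `-1` if `D` is `3` or `5` modulo `8`. If `D` is the discriminant
of a quadratic field `K`, then `a ↦ (D / a)` is the quadratic Dirichlet character attached to
`K` over `ℚ`, which is primitive modulo `|D|`. -/
def kroneckerSymbol (D : ℤ) (a : ℕ) : ℤ :=
  ZMod.χ₈ (D : ZMod 8) ^ padicValNat 2 a * jacobiSym D (a / 2 ^ padicValNat 2 a)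

/-- The Chowla-Selberg number of an imaginary quadratic field `K` of discriminant `-d`:
`b_K = Γ(1/2) * ∏_{0 < a < d} Γ(a / d) ^ (n ε(a) / (4 h_K))`, where `n` is the number of roots of
unity in `K`, `ε` is the quadratic Dirichlet character attached to `K`, and `h_K` is the class
number of `K`. -/
noncomputable def chowlaSelbergNumber (K : Type*) [Field K] [NumberField K] : ℝ :=
  Real.Gamma (1 / 2) *
    ∏ a ∈ Finset.Ioo 0 (NumberField.discr K).natAbs,
      Real.Gamma ((a : ℝ) / ((NumberField.discr K).natAbs : ℝ)) ^
        ((NumberField.Units.torsionOrder K : ℝ) * (kroneckerSymbol (NumberField.discr K) a : ℝ) /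
          (4 * (NumberField.classNumber K : ℝ)))

/-- The field `ℚ(√-d)`, as a subfield of the complex numbers. -/
noncomputable def rationalsAdjoinSqrtNeg (d : ℕ) : IntermediateField ℚ ℂ :=
  ℚ⟮(Complex.I * (Real.sqrt d : ℂ))⟯

theorem isIntegral_I_mul_sqrt (d : ℕ) : IsIntegral ℚ (Complex.I * (Real.sqrt d : ℂ)) := by
  refine IsIntegral.of_pow (n := 2) two_pos ?_
  have h : (Complex.I * (Real.sqrt d : ℂ)) ^ 2 = algebraMap ℚ ℂ (-(d : ℚ)) := by
    rw [mul_pow, Complex.I_sq, ← Complex.ofReal_pow, Real.sq_sqrt (Nat.cast_nonneg d)]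
    simp
  rw [h]
  exact isIntegral_algebraMap

noncomputable instance numberField_rationalsAdjoinSqrtNeg (d : ℕ) :
    NumberField (rationalsAdjoinSqrtNeg d) where
  to_charZero := inferInstance
  to_finiteDimensional := IntermediateField.adjoin.finiteDimensional (isIntegral_I_mul_sqrt d)

/-! Put g(z) = η(z)²η(2z)², so that f₃₂(τ) = g(4τ). The Mellin transform gives L(f₃₂,1) = 2π∫₀^∞
f₃₂(it) dt = (π/2)∫₀^∞ g(it) dt, and this integral becomes a beta integral under x = k(t)², where k
= θ₂²/θ₃² is the elliptic modulus on the imaginary axis. Three facts make the substitution work. The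
function k² decreases from 1 to 0 on (0,∞); it satisfies dx/dt = -πθ₄⁴x; and x and 1 - x are
explicit eta quotients, so that x^(-1/2)(1-x)^(-3/4)|dx| = 4πg(it) dt
(`deriv_mul_beta_integrand_eq`). Hence L(f₃₂,1) = B(1/2,1/4)/8, and both closed forms follow from
Γ(1/4)Γ(3/4) = π√2 and the arithmetic of ℚ(i).

The facts on k rest on Jacobi's identity θ₂⁴ + θ₄⁴ = θ₃⁴: the square of the defect is a level one
cusp form of weight 4, hence zero. Jacobi's identity yields the duplication formulas, thus Landen's
transformation of k. By these, k'/(kθ₄⁴) is invariant under t ↦ 2t, so it equals its limit -π/2 at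
infinity (`ellipticModulusLogDeriv_eq_neg`).

That f₃₂ is a cusp form is proved by descent: g has a fourth root of unity as multiplier on Γ₀(2),
which is trivial on the conjugate of Γ₀(32). Decay at every cusp comes from a bound on |g(z)| Im z.
-/

section

open Complex Filter Topology
open UpperHalfPlane hiding I
open scoped Real MatrixGroups

/-! ### Euler products and the basic identities of eta -/

/-- The Euler product `∏ (1 - q ^ n)` over `n ≥ 1`. -/
noncomputable def eulerProd (q : ℂ) : ℂ := ∏' n : ℕ, (1 - q ^ (n + 1))

/-- The product `∏ (1 - q ^ n)` over odd `n ≥ 1`. -/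
noncomputable def oddEulerProd (q : ℂ) : ℂ := ∏' n : ℕ, (1 - q ^ (2 * n + 1))

theorem multipliable_one_sub_pow_comp {q : ℂ} (hq : ‖q‖ < 1) {e : ℕ → ℕ}
    (he : Function.Injective e) : Multipliable fun n : ℕ ↦ 1 - q ^ e n := by
  have h : Summable fun n : ℕ ↦ ‖-q ^ e n‖ := by
    simpa [Function.comp_def] using
      (summable_geometric_of_lt_one (norm_nonneg _) hq).comp_injective he
  simpa [sub_eq_add_neg] using multipliable_one_add_of_summable h

theorem eulerProd_eq_oddEulerProd_mul {q : ℂ} (hq : ‖q‖ < 1) :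
    eulerProd q = oddEulerProd q * eulerProd (q ^ 2) := by
  have h1 : Multipliable fun k : ℕ ↦ 1 - q ^ (2 * k + 1) :=
    multipliable_one_sub_pow_comp hq fun a b h ↦ by grind
  have h2 : Multipliable fun k : ℕ ↦ 1 - q ^ (2 * k + 1 + 1) :=
    multipliable_one_sub_pow_comp hq fun a b h ↦ by grind
  unfold eulerProd oddEulerProd
  rw [← tprod_even_mul_odd (f := fun n : ℕ ↦ 1 - q ^ (n + 1)) h1 h2]
  congr 1
  exact tprod_congr fun n ↦ by ring

theorem oddEulerProd_mul_neg {q : ℂ} (hq : ‖q‖ < 1) :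
    oddEulerProd q * oddEulerProd (-q) = oddEulerProd (q ^ 2) := by
  have hinj : Function.Injective fun k : ℕ ↦ 2 * k + 1 := fun a b h ↦ by grind
  unfold oddEulerProd
  rw [← Multipliable.tprod_mul (multipliable_one_sub_pow_comp hq hinj)
    (multipliable_one_sub_pow_comp (by simpa using hq) hinj)]
  refine tprod_congr fun n ↦ ?_
  rw [Odd.neg_pow ⟨n, rfl⟩]
  ring

/-- Write E for the full product and O for the odd one. Then E(q) = O(q)E(q²) and O(q)O(-q) = O(q²),
so the left side is O(q²)E(q⁴)E(q²)², and O(q²)E(q⁴) = E(q²). -/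
theorem eulerProd_neg_mul {q : ℂ} (hq : ‖q‖ < 1) :
    eulerProd (-q) * eulerProd q * eulerProd (q ^ 4) = eulerProd (q ^ 2) ^ 3 := by
  have hq2 : ‖q ^ 2‖ < 1 := by simpa using pow_lt_one₀ (norm_nonneg q) hq two_ne_zero
  have h1 := eulerProd_eq_oddEulerProd_mul hq
  have h2 := eulerProd_eq_oddEulerProd_mul (q := -q) (by simpa using hq)
  have h3 := eulerProd_eq_oddEulerProd_mul hq2
  rw [neg_sq] at h2
  rw [← pow_mul] at h3
  rw [h2, h1]
  linear_combination eulerProd (q ^ 2) ^ 2 * eulerProd (q ^ 4) * oddEulerProd_mul_neg hq -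
    eulerProd (q ^ 2) ^ 2 * h3

namespace ModularForm

theorem eta_eq_exp_mul_eulerProd (z : ℂ) :
    eta z = cexp (2 * π * I * z / 24) * eulerProd (cexp (2 * π * I * z)) := by
  unfold eta eulerProd
  congr 1
  simp_rw [eta_q_eq_pow]

theorem eta_add_one (z : ℂ) : eta (z + 1) = cexp (π * I / 12) * eta z := by
  rw [eta_eq_exp_mul_eulerProd, eta_eq_exp_mul_eulerProd, ← mul_assoc, ← Complex.exp_add]
  congr 2
  · ring
  · rw [mul_add, mul_one, Complex.exp_add, exp_two_pi_mul_I, mul_one]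

theorem eta_neg_one_div_sq {z : ℂ} (hz : 0 < z.im) : eta (-1 / z) ^ 2 = -I * z * eta z ^ 2 := by
  have h : eta (-1 / z) = (sqrt I)⁻¹ * (sqrt z * eta z) := by
    simpa using eta_comp_eq_csqrt_I_inv hz
  have hs : ∀ w : ℂ, w ≠ 0 → sqrt w ^ 2 = w := fun w hw ↦ by
    rw [sqrt_eq_exp hw, ← exp_nat_mul]
    push_cast
    rw [mul_div_cancel₀ _ two_ne_zero, exp_log hw]
  have hz0 : z ≠ 0 := by rintro rfl; simp at hz
  rw [h, mul_pow, mul_pow, inv_pow, hs I I_ne_zero, hs z hz0, inv_I]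
  ring

theorem norm_exp_pi_I_lt_one {z : ℂ} (hz : 0 < z.im) : ‖cexp (π * I * z)‖ < 1 := by
  rw [norm_exp]
  simp only [mul_re, ofReal_re, Complex.I_re, mul_zero, ofReal_im, Complex.I_im, mul_one, sub_self,
    zero_mul, mul_im, zero_sub, add_zero]
  rw [Real.exp_lt_one_iff]
  have := mul_pos Real.pi_pos hz
  linarith

/-- With x = exp(πiz), the four arguments have nomes -x, x, x⁴ and x², so this is
`eulerProd_neg_mul` at x. It is Weber's product relation, used to eliminate (z + 1)/2. -/
theorem eta_add_one_div_two_mul {z : ℂ} (hz : 0 < z.im) :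
    eta ((z + 1) / 2) * eta (z / 2) * eta (2 * z) = cexp (π * I / 24) * eta z ^ 3 := by
  have h := eulerProd_neg_mul (norm_exp_pi_I_lt_one hz)
  rw [← exp_nat_mul, ← exp_nat_mul] at h
  rw [eta_eq_exp_mul_eulerProd, eta_eq_exp_mul_eulerProd, eta_eq_exp_mul_eulerProd,
    eta_eq_exp_mul_eulerProd]
  have e1 : cexp (2 * π * I * ((z + 1) / 2)) = -cexp (π * I * z) := by
    rw [show 2 * π * I * ((z + 1) / 2) = π * I * z + π * I by ring, Complex.exp_add, exp_pi_mul_I]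
    ring
  have e2 : 2 * π * I * (z / 2) = π * I * z := by ring
  have e3 : 2 * π * I * (2 * z) = ((4 : ℕ) : ℂ) * (π * I * z) := by push_cast; ring
  have e4 : 2 * π * I * z = ((2 : ℕ) : ℂ) * (π * I * z) := by push_cast; ring
  rw [e1, e2, e3, e4, mul_pow, ← h, ← exp_nat_mul]
  have e5 : cexp (2 * π * I * ((z + 1) / 2) / 24) * cexp (π * I * z / 24) *
      cexp (((4 : ℕ) : ℂ) * (π * I * z) / 24) =
      cexp (π * I / 24) * cexp ((3 : ℕ) * (((2 : ℕ) : ℂ) * (π * I * z) / 24)) := by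
    rw [← Complex.exp_add, ← Complex.exp_add, ← Complex.exp_add]
    congr 1
    push_cast
    ring
  linear_combination eulerProd (-cexp (π * I * z)) * eulerProd (cexp (π * I * z)) *
    eulerProd (cexp ((4 : ℕ) * (π * I * z))) * e5

/-! ### The eta product and its multiplier on Γ₀(2) -/

/-- The eta product `η(z)² η(2z)²`. -/
noncomputable def etaSqProd (z : ℂ) : ℂ := eta z ^ 2 * eta (2 * z) ^ 2

theorem etaSqProd_add_one (z : ℂ) : etaSqProd (z + 1) = I * etaSqProd z := by
  unfold etaSqProd
  rw [show 2 * (z + 1) = 2 * z + 1 + 1 by ring, eta_add_one, eta_add_one, eta_add_one]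
  have h : cexp (π * I / 12) ^ 6 = I := by
    rw [← exp_nat_mul]
    convert exp_pi_div_two_mul_I using 2
    push_cast
    ring
  linear_combination eta z ^ 2 * eta (2 * z) ^ 2 * h

theorem etaSqProd_sub_one (z : ℂ) : etaSqProd (z - 1) = -I * etaSqProd z := by
  have h := etaSqProd_add_one (z - 1)
  rw [sub_add_cancel] at h
  rw [h]
  linear_combination etaSqProd (z - 1) * I_sq

/-- The Fricke involution of level 2 interchanges the two eta factors. -/
theorem etaSqProd_neg_one_div {z : ℂ} (hz : 0 < z.im) :
    etaSqProd (-1 / (2 * z)) = -2 * z ^ 2 * etaSqProd z := by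
  have hz0 : z ≠ 0 := by rintro rfl; simp at hz
  unfold etaSqProd
  rw [show 2 * (-1 / (2 * z)) = -1 / z by field_simp, eta_neg_one_div_sq hz,
    eta_neg_one_div_sq (z := 2 * z) (by simpa using hz)]
  linear_combination 2 * z ^ 2 * eta z ^ 2 * eta (2 * z) ^ 2 * I_sq

theorem two_mul_add_one_ne_zero {z : ℂ} (hz : 0 < z.im) : 2 * z + 1 ≠ 0 := fun h ↦ by
  have := congrArg Complex.im h
  simp at this
  exact hz.ne' this

theorem im_neg_one_div_pos {z : ℂ} (hz : 0 < z.im) : 0 < (-1 / z).im := by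
  have hz0 : z ≠ 0 := by rintro rfl; simp at hz
  rw [neg_div, one_div, neg_im, inv_im, neg_div, neg_neg]
  exact div_pos hz (normSq_pos.mpr hz0)

/-- The lower triangular generator is the translation z ↦ z - 1 conjugated by the Fricke involution,
so its multiplier comes from laws already known. -/
theorem div_two_mul_add_one {z : ℂ} (hz : 0 < z.im) :
    z / (2 * z + 1) = -1 / (2 * (-1 / (2 * z) - 1)) := by
  have hz0 : z ≠ 0 := by rintro rfl; simp at hz
  have h1 := two_mul_add_one_ne_zero hz
  have h2 : 2 * (-1 / (2 * z) - 1) = -(2 * z + 1) / z := by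
    field_simp
    ring
  rw [h2, neg_div z (2 * z + 1), neg_div_neg_eq, one_div_div]

theorem im_div_two_mul_add_one_pos {z : ℂ} (hz : 0 < z.im) : 0 < (z / (2 * z + 1)).im := by
  rw [div_two_mul_add_one hz]
  apply im_neg_one_div_pos
  have h := im_neg_one_div_pos (z := 2 * z) (by simpa using hz)
  simpa using h

theorem etaSqProd_div_two_mul_add_one {z : ℂ} (hz : 0 < z.im) :
    etaSqProd (z / (2 * z + 1)) = -I * (2 * z + 1) ^ 2 * etaSqProd z := by
  have hz0 : z ≠ 0 := by rintro rfl; simp at hz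
  have h := im_neg_one_div_pos (z := 2 * z) (by simpa using hz)
  rw [div_two_mul_add_one hz, etaSqProd_neg_one_div (by simpa using h), etaSqProd_sub_one,
    etaSqProd_neg_one_div hz]
  field_simp
  ring

/-- `η(z)² η(2z)²` transforms under `(a b; 2m d)` as a form of weight `2` with multiplier
`i ^ (d(b - m))`. -/
def EtaSqProdTransforms (a b m d : ℤ) : Prop :=
  ∀ z : ℂ, 0 < z.im → etaSqProd ((a * z + b) / (2 * m * z + d)) =
    I ^ (d * (b - m)) * (2 * m * z + d) ^ 2 * etaSqProd z

theorem I_zpow_eq_of_dvd {m n : ℤ} (h : (4 : ℤ) ∣ m - n) : I ^ m = I ^ n := by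
  obtain ⟨k, hk⟩ := h
  have hI : I ^ (4 : ℤ) = 1 := by exact_mod_cast I_pow_four
  rw [show m = n + 4 * k by linarith, zpow_add₀ I_ne_zero, zpow_mul, hI, one_zpow, mul_one]

theorem I_zpow_add_one (n : ℤ) : I ^ (n + 1) = I ^ n * I := zpow_add_one₀ I_ne_zero n

theorem I_zpow_sub_one (n : ℤ) : I ^ (n - 1) = I ^ n * -I := by
  rw [zpow_sub_one₀ I_ne_zero, inv_I]

theorem odd_of_det {a b m d : ℤ} (h : a * d - b * (2 * m) = 1) : Odd a ∧ Odd d := by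
  have : Odd (a * d) := ⟨b * m, by linarith⟩
  exact Int.odd_mul.mp this

theorem even_mul_add_of_odd {a m : ℤ} (ha : Odd a) : Even (m * (a + m)) := by
  rcases Int.even_or_odd m with hm | hm
  · exact hm.mul_right _
  · exact (ha.add_odd hm).mul_left _

theorem EtaSqProdTransforms.of_sub {a b m d : ℤ} (h : a * d - b * (2 * m) = 1)
    (hP : EtaSqProdTransforms a (b - a) m (d - 2 * m)) : EtaSqProdTransforms a b m d := by
  intro z hz
  have := hP (z + 1) (by simpa using hz)
  rw [etaSqProd_add_one] at this
  push_cast at this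
  rw [show (a : ℂ) * (z + 1) + (b - a) = a * z + b by ring,
    show (2 : ℂ) * m * (z + 1) + (d - 2 * m) = 2 * m * z + d by ring] at this
  rw [this, I_zpow_eq_of_dvd (m := d * (b - m)) (n := (d - 2 * m) * (b - a - m) + 1),
    I_zpow_add_one]
  · ring
  -- By the determinant relation the exponents differ by 4bm - 2m(a + m), and m(a + m) is even.
  · obtain ⟨k, hk⟩ := even_mul_add_of_odd (m := m) (odd_of_det h).1
    exact ⟨b * m - k, by linear_combination h - 2 * hk⟩

theorem EtaSqProdTransforms.of_add {a b m d : ℤ} (h : a * d - b * (2 * m) = 1)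
    (hP : EtaSqProdTransforms a (b + a) m (d + 2 * m)) : EtaSqProdTransforms a b m d := by
  intro z hz
  have := hP (z - 1) (by simpa using hz)
  rw [etaSqProd_sub_one] at this
  push_cast at this
  rw [show (a : ℂ) * (z - 1) + (b + a) = a * z + b by ring,
    show (2 : ℂ) * m * (z - 1) + (d + 2 * m) = 2 * m * z + d by ring] at this
  rw [this, I_zpow_eq_of_dvd (m := d * (b - m)) (n := (d + 2 * m) * (b + a - m) - 1),
    I_zpow_sub_one]
  · ring
  · obtain ⟨k, hk⟩ := even_mul_add_of_odd (m := -m) (odd_of_det h).1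
    exact ⟨-b * m + k, by linear_combination -h + 2 * hk⟩

theorem EtaSqProdTransforms.of_sub_mul {a b m d : ℤ} (h : a * d - b * (2 * m) = 1)
    (hP : EtaSqProdTransforms (a - 2 * b) b (m - d) d) : EtaSqProdTransforms a b m d := by
  intro z hz
  have h0 := two_mul_add_one_ne_zero hz
  have := hP _ (im_div_two_mul_add_one_pos hz)
  rw [etaSqProd_div_two_mul_add_one hz] at this
  push_cast at this
  rw [show ((a : ℂ) - 2 * b) * (z / (2 * z + 1)) + b = (a * z + b) / (2 * z + 1) by
      field_simp; ring,
    show (2 : ℂ) * (m - d) * (z / (2 * z + 1)) + d = (2 * m * z + d) / (2 * z + 1) by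
      field_simp; ring, div_div_div_cancel_right₀ h0] at this
  rw [this, I_zpow_eq_of_dvd (m := d * (b - m)) (n := d * (b - (m - d)) - 1), I_zpow_sub_one]
  · field_simp
  -- The exponents differ by 1 - d², a multiple of 4 because d is odd.
  · obtain ⟨k, rfl⟩ := (odd_of_det h).2
    exact ⟨-(k * k + k), by ring⟩

theorem EtaSqProdTransforms.of_add_mul {a b m d : ℤ} (h : a * d - b * (2 * m) = 1)
    (hP : EtaSqProdTransforms (a + 2 * b) b (m + d) d) : EtaSqProdTransforms a b m d := by
  intro w hw
  have h0 : 1 - 2 * w ≠ 0 := fun h ↦ by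
    have := congrArg Complex.im h
    simp at this
    exact hw.ne' this
  -- The inverse of z ↦ z/(2z + 1); it preserves the half plane since w/(1 - 2w) = -1/(-1/w + 2).
  obtain ⟨z, hz, rfl⟩ : ∃ z : ℂ, 0 < z.im ∧ z / (2 * z + 1) = w := by
    refine ⟨w / (1 - 2 * w), ?_, ?_⟩
    · have := im_neg_one_div_pos (z := -1 / w - -2) (by simpa using im_neg_one_div_pos hw)
      have hw0 : w ≠ 0 := by rintro rfl; simp at hw
      convert this using 2
      have : -1 / w - -2 = -(1 - 2 * w) / w := by field_simp; ring
      rw [this, neg_div w (1 - 2 * w), neg_div_neg_eq, one_div_div]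
    · have : 2 * (w / (1 - 2 * w)) + 1 = 1 / (1 - 2 * w) := by field_simp; ring
      rw [this, div_div_div_cancel_right₀ h0, div_one]
  have h1 := two_mul_add_one_ne_zero hz
  have := hP _ hz
  push_cast at this
  rw [etaSqProd_div_two_mul_add_one hz]
  rw [show (a : ℂ) * (z / (2 * z + 1)) + b = ((a + 2 * b) * z + b) / (2 * z + 1) by
      rw [eq_div_iff h1, add_mul, mul_assoc, div_mul_cancel₀ _ h1]; ring,
    show (2 : ℂ) * m * (z / (2 * z + 1)) + d = (2 * (m + d) * z + d) / (2 * z + 1) by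
      rw [eq_div_iff h1, add_mul, mul_assoc, div_mul_cancel₀ _ h1]; ring,
    div_div_div_cancel_right₀ h1, this,
    I_zpow_eq_of_dvd (m := d * (b - (m + d))) (n := d * (b - m) - 1), I_zpow_sub_one]
  · field_simp
  · obtain ⟨k, rfl⟩ := (odd_of_det h).2
    exact ⟨-(k * k + k), by ring⟩

theorem etaSqProd_add_natCast (z : ℂ) (n : ℕ) : etaSqProd (z + n) = I ^ n * etaSqProd z := by
  induction n with
  | zero => simp
  | succ n ih =>
    push_cast
    rw [← add_assoc, etaSqProd_add_one, ih, pow_succ]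
    ring

theorem etaSqProd_add_intCast (z : ℂ) (n : ℤ) : etaSqProd (z + n) = I ^ n * etaSqProd z := by
  obtain ⟨n, rfl | rfl⟩ := n.eq_nat_or_neg
  · exact_mod_cast etaSqProd_add_natCast z n
  · have := etaSqProd_add_natCast (z + (-(n : ℤ) : ℤ)) n
    push_cast at this ⊢
    rw [neg_add_cancel_right] at this
    rw [this, zpow_neg, zpow_natCast, inv_mul_cancel_left₀ (pow_ne_zero _ I_ne_zero)]

/-- Euclidean descent on the bottom row: right multiplication by a generator replaces d by d ∓ 2m or
m by m ∓ d, and whichever of |d|, 2|m| is larger can be decreased. The descent ends at m = 0, where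
the matrix is a translation up to sign. -/
theorem etaSqProdTransforms {a b m d : ℤ} (h : a * d - b * (2 * m) = 1) :
    EtaSqProdTransforms a b m d := by
  induction hn : 2 * m.natAbs + d.natAbs using Nat.strong_induction_on generalizing a b m d with
  | _ n ih =>
    obtain ⟨k, hk⟩ := (odd_of_det h).2
    rcases eq_or_ne m 0 with rfl | hm
    · intro z hz
      rcases Int.eq_one_or_neg_one_of_mul_eq_one' (u := a) (v := d) (by linarith) with
        ⟨rfl, rfl⟩ | ⟨rfl, rfl⟩
      · simpa using etaSqProd_add_intCast z b
      · have := etaSqProd_add_intCast z (-b)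
        simp only [Int.cast_neg, zpow_neg] at this
        simpa [div_neg, neg_div, neg_add_rev, add_comm] using this
    -- A tie is impossible because d is odd.
    · rcases lt_or_gt_of_ne (show 2 * m.natAbs ≠ d.natAbs by omega) with hlt | hlt
      · by_cases hs : 0 < m * d
        · refine .of_sub h (ih _ ?_ (by linear_combination h) rfl)
          rcases pos_and_pos_or_neg_and_neg_of_mul_pos hs with ⟨h1, h2⟩ | ⟨h1, h2⟩ <;> omega
        · have hs' : m * d < 0 := lt_of_le_of_ne (not_lt.mp hs) (mul_ne_zero hm (by omega))
          refine .of_add h (ih _ ?_ (by linear_combination h) rfl)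
          rcases mul_neg_iff.mp hs' with ⟨h1, h2⟩ | ⟨h1, h2⟩ <;> omega
      · by_cases hs : 0 < m * d
        · refine .of_sub_mul h (ih _ ?_ (by linear_combination h) rfl)
          rcases pos_and_pos_or_neg_and_neg_of_mul_pos hs with ⟨h1, h2⟩ | ⟨h1, h2⟩ <;> omega
        · have hs' : m * d < 0 := lt_of_le_of_ne (not_lt.mp hs) (mul_ne_zero hm (by omega))
          refine .of_add_mul h (ih _ ?_ (by linear_combination h) rfl)
          rcases mul_neg_iff.mp hs' with ⟨h1, h2⟩ | ⟨h1, h2⟩ <;> omega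

/-! ### Growth bounds and the cusp form of level 32 -/

theorem exists_norm_eta_pow_four_mul_im_le :
    ∃ C : ℝ, 0 ≤ C ∧ ∀ z : ℂ, 0 < z.im → ‖eta z‖ ^ 4 * z.im ≤ C := by
  obtain ⟨C, hC⟩ := CuspFormClass.exists_bound CuspForm.discriminant
  -- The cusp form Δ = η²⁴ gives (|η|⁴ Im z)⁶ ≤ C. The maximum with 1 avoids a sixth root: a number
  -- x > 1 satisfies x ≤ x⁶.
  refine ⟨max 1 C, by positivity, fun z hz ↦ ?_⟩
  have h := hC ⟨z, hz⟩
  have he : (((12 : ℤ) : ℝ) / 2 : ℝ) = (6 : ℕ) := by norm_num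
  rw [he, Real.rpow_natCast, CuspForm.coe_discriminant, discriminant, norm_pow,
    le_div_iff₀ (by positivity)] at h
  change ‖eta z‖ ^ 24 * z.im ^ 6 ≤ C at h
  by_contra! hlt
  rw [max_lt_iff] at hlt
  have h1 := le_self_pow₀ hlt.1.le (n := 6) (by norm_num)
  nlinarith

/-- The square of the left side is the product of |η(z)|⁴ Im z and |η(2z)|⁴ Im z, both bounded by
the previous lemma. -/
theorem exists_norm_etaSqProd_mul_im_le :
    ∃ C : ℝ, 0 ≤ C ∧ ∀ z : ℂ, 0 < z.im → ‖etaSqProd z‖ * z.im ≤ C := by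
  obtain ⟨C, hC0, hC⟩ := exists_norm_eta_pow_four_mul_im_le
  refine ⟨C, hC0, fun z hz ↦ ?_⟩
  have h1 := hC z hz
  have h2 := hC (2 * z) (by simpa using hz)
  have him : (2 * z).im = 2 * z.im := by simp
  rw [him] at h2
  have h3 : ‖eta (2 * z)‖ ^ 4 * z.im ≤ C := by
    have : 0 ≤ ‖eta (2 * z)‖ ^ 4 * z.im := by positivity
    linarith
  rw [etaSqProd, norm_mul, norm_pow, norm_pow]
  refine le_of_sq_le_sq ?_ hC0
  calc _ = (‖eta z‖ ^ 4 * z.im) * (‖eta (2 * z)‖ ^ 4 * z.im) := by ring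
    _ ≤ C * C := by gcongr
    _ = C ^ 2 := by ring

theorem differentiableAt_etaSqProd {z : ℂ} (hz : 0 < z.im) : DifferentiableAt ℂ etaSqProd z := by
  have h1 := differentiableAt_eta_of_mem_upperHalfPlaneSet hz
  have h2 : DifferentiableAt ℂ eta (2 * z) :=
    differentiableAt_eta_of_mem_upperHalfPlaneSet (by simpa using hz)
  exact (h1.pow 2).mul ((h2.comp z (by fun_prop : DifferentiableAt ℂ (2 * ·) z)).pow 2)

/-- Conjugation by τ ↦ 4τ turns (a b; 32m d) into (a 4b; 8m d), whose multiplier exponent 4d(b - m)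
is divisible by 4. -/
theorem etaSqProd_slash_eq {γ : Matrix.SpecialLinearGroup (Fin 2) ℤ}
    (hγ : γ ∈ CongruenceSubgroup.Gamma0 32) :
    ((fun τ : ℍ ↦ etaSqProd (4 * τ)) ∣[(2 : ℤ)] γ) = fun τ : ℍ ↦ etaSqProd (4 * τ) := by
  rw [CongruenceSubgroup.Gamma0_mem, ZMod.intCast_zmod_eq_zero_iff_dvd] at hγ
  obtain ⟨m, hm⟩ := hγ
  have hdet := γ.det_coe
  rw [Matrix.det_fin_two, hm] at hdet
  ext τ
  have h := etaSqProdTransforms (a := γ 0 0) (b := 4 * γ 0 1) (m := 4 * m) (d := γ 1 1)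
    (by push_cast at hdet; linear_combination hdet) (4 * τ) (by simpa using τ.im_pos)
  rw [I_zpow_eq_of_dvd (n := 0) ⟨γ 1 1 * (γ 0 1 - m), by ring⟩, zpow_zero, one_mul] at h
  have hd : denom γ τ = 2 * ((4 * m : ℤ) : ℂ) * (4 * τ) + (γ 1 1 : ℤ) := by
    rw [ModularGroup.denom_apply, hm]
    push_cast
    ring
  have hd0 : denom γ τ ≠ 0 := denom_ne_zero _ _
  rw [SL_slash_apply, coe_specialLinearGroup_apply]
  have harg : (4 : ℂ) * ((((algebraMap ℤ ℝ) (γ 0 0) : ℝ) * (τ : ℂ) +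
      ((algebraMap ℤ ℝ) (γ 0 1) : ℝ)) /
      (((algebraMap ℤ ℝ) (γ 1 0) : ℝ) * (τ : ℂ) + ((algebraMap ℤ ℝ) (γ 1 1) : ℝ))) =
      ((γ 0 0 : ℤ) * (4 * (τ : ℂ)) + (4 * γ 0 1 : ℤ)) /
        (2 * ((4 * m : ℤ) : ℂ) * (4 * τ) + (γ 1 1 : ℤ)) := by
    rw [← mul_div_assoc, hm]
    simp only [algebraMap_int_eq, eq_intCast, ofReal_intCast]
    push_cast
    ring_nf
  rw [harg, h, ← hd]
  simp only [zpow_neg]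
  rw [show denom γ τ ^ (2 : ℤ) = denom γ τ ^ 2 from zpow_ofNat _ 2]
  field_simp

/-- Since Im γτ = Im τ/|cτ + d|², the uniform bound on |g(z)| Im z makes every slash translate
O(1/Im τ). All cusps are thus handled at once, without expansions. -/
theorem isZeroAtImInfty_etaSqProd_slash (γ : Matrix.SpecialLinearGroup (Fin 2) ℤ) :
    IsZeroAtImInfty ((fun τ : ℍ ↦ etaSqProd (4 * τ)) ∣[(2 : ℤ)] γ) := by
  obtain ⟨C, hC0, hC⟩ := exists_norm_etaSqProd_mul_im_le
  rw [isZeroAtImInfty_iff]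
  intro ε hε
  refine ⟨C / ε, fun τ hτ ↦ ?_⟩
  have hd0 : denom γ τ ≠ 0 := denom_ne_zero _ _
  have hn : 0 < normSq (denom γ τ) := normSq_pos.mpr hd0
  have h := hC (4 * (γ • τ : ℍ)) (by simpa using (γ • τ).im_pos)
  have him : (4 * ((γ • τ : ℍ) : ℂ)).im = 4 * (τ.im / normSq (denom γ τ)) := by
    rw [← ModularGroup.im_smul_eq_div_normSq]
    simp
  rw [him] at h
  rw [SL_slash_apply, norm_mul, norm_zpow, zpow_neg,
    show ‖denom γ τ‖ ^ (2 : ℤ) = normSq (denom γ τ) by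
      rw [normSq_eq_norm_sq]; exact zpow_ofNat _ 2]
  have hτ' : C ≤ τ.im * ε := (div_le_iff₀ hε).mp hτ
  have hpos := τ.im_pos
  set x := ‖etaSqProd (4 * ((γ • τ : ℍ) : ℂ))‖
  set N := normSq (denom γ τ)
  have hx : 0 ≤ x * N⁻¹ := by positivity
  have h' : 4 * (x * N⁻¹) * τ.im ≤ C := by
    calc _ = x * (4 * (τ.im / N)) := by ring
      _ ≤ C := h
  nlinarith

/-- The cusp form `η(4τ)² η(8τ)²` of weight `2` and level `32`. -/
noncomputable def etaCuspForm :
    CuspForm ((CongruenceSubgroup.Gamma0 32).map (Matrix.SpecialLinearGroup.mapGL ℝ)) 2 where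
  toFun τ := etaSqProd (4 * τ)
  slash_action_eq' A hA := by
    obtain ⟨γ, hγ, rfl⟩ := hA
    exact etaSqProd_slash_eq hγ
  holo' := by
    rw [UpperHalfPlane.mdifferentiable_iff]
    refine DifferentiableOn.congr (f := fun z ↦ etaSqProd (4 * z)) (fun z hz ↦ ?_) fun z hz ↦ ?_
    · have h : DifferentiableAt ℂ etaSqProd (4 * z) :=
        differentiableAt_etaSqProd (by simpa using hz)
      exact (h.comp z (by fun_prop : DifferentiableAt ℂ (4 * ·) z)).differentiableWithinAt
    · simp [ofComplex_apply_of_im_pos hz]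
  zero_at_cusps' hc := by
    rw [Subgroup.IsArithmetic.isCusp_iff_isCusp_SL2Z] at hc
    rw [OnePoint.isZeroAt_iff_forall_SL2Z hc]
    exact fun γ _ ↦ isZeroAtImInfty_etaSqProd_slash γ

theorem etaCuspForm_apply (τ : ℍ) : etaCuspForm τ = etaSqProd (4 * τ) := rfl

/-! ### The central L-value as an integral -/

theorem L_one_eq_integral {Γ : Subgroup (GL (Fin 2) ℝ)} [Γ.IsArithmetic] {k : ℤ} (hk : 0 < k)
    (f : CuspForm Γ k) : L hk f 1 = 2 * π * ∫ t in Set.Ioi (0 : ℝ), f (ofComplex (I * t)) := by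
  have hG : (Gammaℂ 1) = (π : ℂ)⁻¹ := by
    rw [Gammaℂ, Complex.Gamma_one, cpow_neg_one]
    have : (π : ℂ) ≠ 0 := ofReal_ne_zero.mpr Real.pi_ne_zero
    field_simp
  rw [L, CuspForm.Λ_eq_mellin, mellin, hG]
  simp only [sub_self, cpow_zero, one_smul]
  rw [div_inv_eq_mul]
  ring

theorem L_etaCuspForm_one_eq_integral :
    L two_pos etaCuspForm 1 = π / 2 * ∫ t in Set.Ioi (0 : ℝ), etaSqProd (I * t) := by
  rw [L_one_eq_integral]
  have h : ∫ t in Set.Ioi (0 : ℝ), etaCuspForm (ofComplex (I * t)) =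
      ∫ t in Set.Ioi (0 : ℝ), (fun t : ℝ ↦ etaSqProd (I * t)) (4 * t) := by
    refine MeasureTheory.setIntegral_congr_fun measurableSet_Ioi fun t ht ↦ ?_
    have ht' : 0 < (I * t : ℂ).im := by simpa using ht
    simp only [etaCuspForm_apply, ofComplex_apply_of_im_pos ht']
    congr 1
    push_cast
    ring
  rw [h, MeasureTheory.integral_comp_mul_left_Ioi (fun t : ℝ ↦ etaSqProd (I * t)) 0
    (by norm_num : (0 : ℝ) < 4), mul_zero, real_smul]
  push_cast
  ring

end ModularForm

/-! ### Theta constants as eta quotients and Jacobi's identity -/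

theorem continuousAt_eulerProd {q : ℂ} (hq : ‖q‖ < 1) : ContinuousAt eulerProd q :=
  (ModularForm.differentiableOn_tprod_one_sub_pow.differentiableAt
    (Metric.isOpen_ball.mem_nhds (by simpa using hq))).continuousAt

theorem eulerProd_zero : eulerProd 0 = 1 := by simp [eulerProd]

theorem tendsto_eulerProd_zero : Tendsto eulerProd (𝓝 0) (𝓝 1) := by
  simpa [ContinuousAt, eulerProd_zero] using continuousAt_eulerProd (q := 0) (by simp)

namespace ModularForm

/-- The fourth power of the theta constant `θ₂` as an eta quotient. -/
noncomputable def thetaTwoPow (z : ℂ) : ℂ := 16 * eta (2 * z) ^ 8 / eta z ^ 4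

/-- The fourth power of the theta constant `θ₃` as an eta quotient. -/
noncomputable def thetaThreePow (z : ℂ) : ℂ :=
  cexp (-(π * I / 3)) * eta ((z + 1) / 2) ^ 8 / eta z ^ 4

/-- The fourth power of the theta constant `θ₄` as an eta quotient. -/
noncomputable def thetaFourPow (z : ℂ) : ℂ := eta (z / 2) ^ 8 / eta z ^ 4

theorem exp_pi_mul_I_div_three_ne_zero : cexp (π * I / 3) ≠ 0 := Complex.exp_ne_zero _

theorem eta_add_one_pow_four (z : ℂ) : eta (z + 1) ^ 4 = cexp (π * I / 3) * eta z ^ 4 := by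
  rw [eta_add_one, mul_pow, ← exp_nat_mul]
  congr 2
  push_cast
  ring

theorem exp_pi_mul_I_div_three_pow_three : cexp (π * I / 3) ^ 3 = -1 := by
  rw [← exp_nat_mul, ← exp_pi_mul_I]
  congr 1
  push_cast
  ring

theorem thetaTwoPow_add_one (z : ℂ) : thetaTwoPow (z + 1) = -thetaTwoPow z := by
  have h := exp_pi_mul_I_div_three_ne_zero
  have h3 := exp_pi_mul_I_div_three_pow_three
  have h2 : eta (2 * (z + 1)) ^ 4 = cexp (π * I / 3) ^ 2 * eta (2 * z) ^ 4 := by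
    rw [show 2 * (z + 1) = 2 * z + 1 + 1 by ring, eta_add_one_pow_four, eta_add_one_pow_four]
    ring
  rw [thetaTwoPow, thetaTwoPow, eta_add_one_pow_four,
    show eta (2 * (z + 1)) ^ 8 = (eta (2 * (z + 1)) ^ 4) ^ 2 by ring, h2, ← neg_div,
    show 16 * (cexp (π * I / 3) ^ 2 * eta (2 * z) ^ 4) ^ 2 =
      cexp (π * I / 3) * (cexp (π * I / 3) ^ 3 * 16 * eta (2 * z) ^ 8) by ring,
    mul_div_mul_left _ _ h, h3]
  ring

theorem thetaThreePow_add_one (z : ℂ) : thetaThreePow (z + 1) = thetaFourPow z := by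
  have h := exp_pi_mul_I_div_three_ne_zero
  rw [thetaThreePow, thetaFourPow, eta_add_one_pow_four,
    show (z + 1 + 1) / 2 = z / 2 + 1 by ring,
    show eta (z / 2 + 1) ^ 8 = (eta (z / 2 + 1) ^ 4) ^ 2 by ring, eta_add_one_pow_four,
    Complex.exp_neg]
  rw [show (cexp (π * I / 3))⁻¹ * (cexp (π * I / 3) * eta (z / 2) ^ 4) ^ 2 =
    cexp (π * I / 3) * eta (z / 2) ^ 8 by field_simp, mul_div_mul_left _ _ h]

theorem thetaFourPow_add_one (z : ℂ) : thetaFourPow (z + 1) = thetaThreePow z := by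
  rw [thetaThreePow, thetaFourPow, eta_add_one_pow_four, Complex.exp_neg, inv_mul_eq_div,
    div_div]

theorem eta_neg_one_div_pow_four {z : ℂ} (hz : 0 < z.im) :
    eta (-1 / z) ^ 4 = -z ^ 2 * eta z ^ 4 := by
  rw [show eta (-1 / z) ^ 4 = (eta (-1 / z) ^ 2) ^ 2 by ring, eta_neg_one_div_sq hz]
  linear_combination z ^ 2 * eta z ^ 4 * I_sq

/-- Weber's relation removes η((z + 1)/2). This form behaves well under inversion and is visibly
real on the imaginary axis. -/
theorem thetaThreePow_eq {z : ℂ} (hz : 0 < z.im) :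
    thetaThreePow z = eta z ^ 20 / (eta (z / 2) ^ 8 * eta (2 * z) ^ 8) := by
  have h := congrArg (· ^ 8) (eta_add_one_div_two_mul hz)
  have he : cexp (π * I / 24) ^ 8 = cexp (π * I / 3) := by
    rw [← exp_nat_mul]
    congr 1
    push_cast
    ring
  simp only [mul_pow, he] at h
  have h0 : eta z ≠ 0 := eta_ne_zero hz
  have h1 : eta (z / 2) ≠ 0 := eta_ne_zero (by simpa using hz)
  have h2 : eta (2 * z) ≠ 0 := eta_ne_zero (by simpa using hz)
  have h3 := exp_pi_mul_I_div_three_ne_zero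
  rw [thetaThreePow, Complex.exp_neg]
  generalize eta (2 * z) = y at *
  field_simp
  linear_combination h

theorem thetaTwoPow_neg_one_div {z : ℂ} (hz : 0 < z.im) :
    thetaTwoPow (-1 / z) = -z ^ 2 * thetaFourPow z := by
  have hz0 : z ≠ 0 := by rintro rfl; simp at hz
  have h0 : eta z ≠ 0 := eta_ne_zero hz
  rw [thetaTwoPow, thetaFourPow, eta_neg_one_div_pow_four hz,
    show 2 * (-1 / z) = -1 / (z / 2) by field_simp,
    show eta (-1 / (z / 2)) ^ 8 = (eta (-1 / (z / 2)) ^ 4) ^ 2 by ring,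
    eta_neg_one_div_pow_four (by simpa using hz)]
  field_simp
  ring

theorem thetaFourPow_neg_one_div {z : ℂ} (hz : 0 < z.im) :
    thetaFourPow (-1 / z) = -z ^ 2 * thetaTwoPow z := by
  have hz0 : z ≠ 0 := by rintro rfl; simp at hz
  have h0 : eta z ≠ 0 := eta_ne_zero hz
  rw [thetaTwoPow, thetaFourPow, eta_neg_one_div_pow_four hz,
    show -1 / z / 2 = -1 / (2 * z) by field_simp,
    show eta (-1 / (2 * z)) ^ 8 = (eta (-1 / (2 * z)) ^ 4) ^ 2 by ring,
    eta_neg_one_div_pow_four (by simpa using hz)]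
  field_simp
  ring

theorem thetaThreePow_neg_one_div {z : ℂ} (hz : 0 < z.im) :
    thetaThreePow (-1 / z) = -z ^ 2 * thetaThreePow z := by
  have hz0 : z ≠ 0 := by rintro rfl; simp at hz
  have h0 : eta z ≠ 0 := eta_ne_zero hz
  have h1 : eta (z / 2) ≠ 0 := eta_ne_zero (by simpa using hz)
  have h2 : eta (2 * z) ≠ 0 := eta_ne_zero (by simpa using hz)
  rw [thetaThreePow_eq hz, thetaThreePow_eq (im_neg_one_div_pos hz),
    show -1 / z / 2 = -1 / (2 * z) by field_simp, show 2 * (-1 / z) = -1 / (z / 2) by field_simp,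
    show eta (-1 / (2 * z)) ^ 8 = (eta (-1 / (2 * z)) ^ 4) ^ 2 by ring,
    show eta (-1 / (z / 2)) ^ 8 = (eta (-1 / (z / 2)) ^ 4) ^ 2 by ring,
    show eta (-1 / z) ^ 20 = (eta (-1 / z) ^ 4) ^ 5 by ring,
    eta_neg_one_div_pow_four hz, eta_neg_one_div_pow_four (z := 2 * z) (by simpa using hz),
    eta_neg_one_div_pow_four (z := z / 2) (by simpa using hz)]
  field_simp

/-- The difference of the two sides of Jacobi's identity `θ₂⁴ + θ₄⁴ = θ₃⁴`. -/
noncomputable def jacobiDefect (z : ℂ) : ℂ := thetaTwoPow z + thetaFourPow z - thetaThreePow z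

theorem jacobiDefect_add_one (z : ℂ) : jacobiDefect (z + 1) = -jacobiDefect z := by
  rw [jacobiDefect, jacobiDefect, thetaTwoPow_add_one, thetaThreePow_add_one, thetaFourPow_add_one]
  ring

theorem jacobiDefect_neg_one_div {z : ℂ} (hz : 0 < z.im) :
    jacobiDefect (-1 / z) = -z ^ 2 * jacobiDefect z := by
  rw [jacobiDefect, jacobiDefect, thetaTwoPow_neg_one_div hz, thetaThreePow_neg_one_div hz,
    thetaFourPow_neg_one_div hz]
  ring

theorem differentiableAt_jacobiDefect {z : ℂ} (hz : 0 < z.im) :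
    DifferentiableAt ℂ jacobiDefect z := by
  have h0 : eta z ^ 4 ≠ 0 := pow_ne_zero _ (eta_ne_zero hz)
  have h1 := differentiableAt_eta_of_mem_upperHalfPlaneSet hz
  have h2 : DifferentiableAt ℂ (fun z ↦ eta (2 * z)) z :=
    DifferentiableAt.comp z (g := eta) (differentiableAt_eta_of_mem_upperHalfPlaneSet
      (by simpa using hz)) (by fun_prop)
  have h3 : DifferentiableAt ℂ (fun z ↦ eta (z / 2)) z :=
    DifferentiableAt.comp z (g := eta) (differentiableAt_eta_of_mem_upperHalfPlaneSet
      (by simpa using hz)) (by fun_prop)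
  have h4 : DifferentiableAt ℂ (fun z ↦ eta ((z + 1) / 2)) z :=
    DifferentiableAt.comp z (g := eta) (differentiableAt_eta_of_mem_upperHalfPlaneSet
      (by simpa using hz)) (by fun_prop)
  unfold jacobiDefect thetaTwoPow thetaThreePow thetaFourPow
  exact ((((h2.pow 8).const_mul 16).div (h1.pow 4) h0).add ((h3.pow 8).div (h1.pow 4) h0)).sub
    (((h4.pow 8).const_mul _).div (h1.pow 4) h0)

theorem eta_pow_eq (z : ℂ) (n : ℕ) :
    eta z ^ n = cexp (n * (2 * π * I * z / 24)) * eulerProd (cexp (2 * π * I * z)) ^ n := by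
  rw [eta_eq_exp_mul_eulerProd, mul_pow, ← exp_nat_mul]

theorem thetaTwoPow_eq_eulerProd (z : ℂ) : thetaTwoPow z = 16 * cexp (π * I * z) *
    eulerProd (cexp (π * I * z) ^ 4) ^ 8 / eulerProd (cexp (π * I * z) ^ 2) ^ 4 := by
  rw [thetaTwoPow, eta_pow_eq, eta_pow_eq, ← exp_nat_mul, ← exp_nat_mul,
    show cexp ((8 : ℕ) * (2 * π * I * (2 * z) / 24)) =
      cexp ((4 : ℕ) * (2 * π * I * z / 24)) * cexp (π * I * z) by
        rw [← Complex.exp_add]; congr 1; push_cast; ring, mul_assoc, mul_left_comm,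
    mul_div_mul_left _ _ (Complex.exp_ne_zero _),
    show 2 * π * I * (2 * z) = ((4 : ℕ) : ℂ) * (π * I * z) by push_cast; ring,
    show 2 * π * I * z = ((2 : ℕ) : ℂ) * (π * I * z) by push_cast; ring]
  ring

theorem thetaFourPow_eq_eulerProd (z : ℂ) : thetaFourPow z =
    eulerProd (cexp (π * I * z)) ^ 8 / eulerProd (cexp (π * I * z) ^ 2) ^ 4 := by
  rw [thetaFourPow, eta_pow_eq, eta_pow_eq, ← exp_nat_mul,
    show (8 : ℕ) * (2 * π * I * (z / 2) / 24) = (4 : ℕ) * (2 * π * I * z / 24) by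
      push_cast; ring, mul_div_mul_left _ _ (Complex.exp_ne_zero _),
    show 2 * π * I * (z / 2) = π * I * z by ring,
    show 2 * π * I * z = ((2 : ℕ) : ℂ) * (π * I * z) by push_cast; ring]

theorem thetaThreePow_eq_eulerProd (z : ℂ) : thetaThreePow z =
    eulerProd (-cexp (π * I * z)) ^ 8 / eulerProd (cexp (π * I * z) ^ 2) ^ 4 := by
  rw [← thetaFourPow_add_one, thetaFourPow_eq_eulerProd, mul_add, Complex.exp_add, mul_one,
    exp_pi_mul_I, mul_neg_one, neg_sq]

/-- In the variable exp(πiτ) → 0, the terms θ₂⁴, θ₄⁴, θ₃⁴ tend to 0, 1, 1. -/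
theorem isZeroAtImInfty_jacobiDefect : IsZeroAtImInfty fun τ : ℍ ↦ jacobiDefect τ := by
  have hx : Tendsto (fun τ : ℍ ↦ cexp (π * I * τ)) atImInfty (𝓝 0) := by
    refine (UpperHalfPlane.qParam_tendsto_atImInfty two_pos).congr fun τ ↦ ?_
    rw [Function.Periodic.qParam]
    congr 1
    push_cast
    ring
  have hp : ∀ n : ℕ, n ≠ 0 → Tendsto (fun x : ℂ ↦ eulerProd (x ^ n)) (𝓝 0) (𝓝 1) := fun n hn ↦
    tendsto_eulerProd_zero.comp (by simpa [hn] using (continuous_pow (M := ℂ) n).tendsto 0)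
  have hm : Tendsto (fun x : ℂ ↦ eulerProd (-x)) (𝓝 0) (𝓝 1) :=
    tendsto_eulerProd_zero.comp (by simpa using (continuous_neg (G := ℂ)).tendsto 0)
  have h2 := (((tendsto_id (α := ℂ) (x := 𝓝 0)).const_mul 16).mul ((hp 4 (by simp)).pow 8)).div
    ((hp 2 (by simp)).pow 4) (by simp)
  have h4 := (tendsto_eulerProd_zero.pow 8).div ((hp 2 (by simp)).pow 4) (by simp)
  have h3 := (hm.pow 8).div ((hp 2 (by simp)).pow 4) (by simp)
  have h := ((h2.add h4).sub h3).comp hx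
  simp only [mul_zero, zero_mul, zero_div, one_pow, zero_add, sub_self] at h
  refine h.congr fun τ ↦ ?_
  simp only [jacobiDefect, thetaTwoPow_eq_eulerProd, thetaThreePow_eq_eulerProd,
    thetaFourPow_eq_eulerProd]
  rfl

/-- The defect has weight 2 with sign -1 under both generators; squaring removes the signs and
leaves level one. -/
theorem jacobiDefect_sq_slash_S : ((fun τ : ℍ ↦ jacobiDefect τ ^ 2) ∣[(4 : ℤ)] ModularGroup.S) =
    fun τ : ℍ ↦ jacobiDefect τ ^ 2 := by
  ext τ
  have h := jacobiDefect_neg_one_div τ.im_pos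
  have h0 := ne_zero τ
  rw [SL_slash_apply, modular_S_smul, ModularGroup.denom_S]
  change jacobiDefect (-(τ : ℂ))⁻¹ ^ 2 * _ = _
  rw [show (-(τ : ℂ))⁻¹ = -1 / τ by rw [neg_div, one_div, inv_neg], h, zpow_neg,
    show (τ : ℂ) ^ (4 : ℤ) = (τ : ℂ) ^ 4 from zpow_ofNat _ 4]
  field_simp

theorem jacobiDefect_sq_slash_T : ((fun τ : ℍ ↦ jacobiDefect τ ^ 2) ∣[(4 : ℤ)] ModularGroup.T) =
    fun τ : ℍ ↦ jacobiDefect τ ^ 2 := by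
  ext τ
  have h := jacobiDefect_add_one τ
  rw [SL_slash_apply, modular_T_smul, ModularGroup.denom_apply]
  simp only [coe_vadd, ofReal_one, add_comm (1 : ℂ), h]
  simp [ModularGroup.T]

/-- The square of `jacobiDefect`, as a cusp form of level one. -/
noncomputable def jacobiDefectSq : CuspForm 𝒮ℒ 4 where
  toFun τ := jacobiDefect τ ^ 2
  slash_action_eq' A hA := by
    obtain ⟨A, rfl⟩ := hA
    exact SlashInvariantForm.slash_action_generators_SL2Z jacobiDefect_sq_slash_S
      jacobiDefect_sq_slash_T A
  holo' := by
    rw [UpperHalfPlane.mdifferentiable_iff]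
    refine DifferentiableOn.congr (f := fun z ↦ jacobiDefect z ^ 2)
      (fun z hz ↦ ((differentiableAt_jacobiDefect hz).pow 2).differentiableWithinAt)
      fun z hz ↦ ?_
    simp [ofComplex_apply_of_im_pos hz]
  zero_at_cusps' hc := by
    rw [Subgroup.IsArithmetic.isCusp_iff_isCusp_SL2Z] at hc
    rw [OnePoint.isZeroAt_iff_forall_SL2Z hc]
    intro γ _
    rw [SlashInvariantForm.slash_action_generators_SL2Z jacobiDefect_sq_slash_S
      jacobiDefect_sq_slash_T]
    simpa [IsZeroAtImInfty, ZeroAtFilter] using Tendsto.pow isZeroAtImInfty_jacobiDefect 2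

/-- Jacobi's identity `θ₂⁴ + θ₄⁴ = θ₃⁴` for eta quotients. -/
theorem thetaTwoPow_add_thetaFourPow {z : ℂ} (hz : 0 < z.im) :
    thetaTwoPow z + thetaFourPow z = thetaThreePow z := by
  have h : jacobiDefectSq = 0 :=
    -- Level one has no nonzero cusp forms of weight below 12.
    rank_zero_iff_forall_zero.mp (CuspForm.rank_eq_zero_of_weight_lt_twelve (by norm_num)) _
  have h2 : jacobiDefect z ^ 2 = 0 := DFunLike.congr_fun h (⟨z, hz⟩ : ℍ)
  exact sub_eq_zero.mp (pow_eq_zero_iff two_ne_zero |>.mp h2)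

end ModularForm

/-! ### Eta on the imaginary axis and its logarithmic derivative -/

theorem eulerProd_ofReal (r : ℝ) : eulerProd r = ((∏' n : ℕ, (1 - r ^ (n + 1)) : ℝ) : ℂ) := by
  have h := Function.LeftInverse.map_tprod (g := ofRealHom) (L := .unconditional ℕ)
    (fun n : ℕ ↦ (1 - r ^ (n + 1) : ℝ))
    continuous_ofReal Complex.continuous_re fun _ ↦ ofReal_re _
  rw [ofRealHom_eq_coe] at h
  rw [eulerProd, h]
  simp

namespace ModularForm

/-- The Dedekind eta function on the imaginary axis, as a real function. -/
noncomputable def etaIm (t : ℝ) : ℝ := (eta (I * t)).re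

theorem ofReal_etaIm (t : ℝ) : (etaIm t : ℂ) = eta (I * t) := by
  have h : eta (I * t) = ((Real.exp (-(2 * π * t / 24)) *
      ∏' n : ℕ, (1 - Real.exp (-(2 * π * t)) ^ (n + 1)) : ℝ) : ℂ) := by
    have e : ∀ x : ℂ, 2 * π * I * (I * x) = -(2 * π * x) := fun x ↦ by
      linear_combination 2 * π * x * I_sq
    rw [eta_eq_exp_mul_eulerProd, e, ofReal_mul, ← eulerProd_ofReal]
    push_cast
    rw [neg_div]
  rw [etaIm, h, ofReal_re]

theorem im_I_mul_ofReal_pos {t : ℝ} (ht : 0 < t) : 0 < (I * t : ℂ).im := by simpa using ht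

theorem etaIm_ne_zero {t : ℝ} (ht : 0 < t) : etaIm t ≠ 0 := by
  have h : eta (I * t) ≠ 0 := eta_ne_zero (im_I_mul_ofReal_pos ht)
  rw [← ofReal_etaIm] at h
  exact_mod_cast h

/-- The logarithmic derivative of `etaIm`. -/
noncomputable def etaImLogDeriv (t : ℝ) : ℝ := (I * (deriv eta (I * t) / eta (I * t))).re

theorem hasDerivAt_etaIm {t : ℝ} (ht : 0 < t) :
    HasDerivAt etaIm (etaImLogDeriv t * etaIm t) t := by
  have h1 : HasDerivAt eta (deriv eta (I * t)) (I * t) :=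
    (differentiableAt_eta_of_mem_upperHalfPlaneSet (im_I_mul_ofReal_pos ht)).hasDerivAt
  have h2 : HasDerivAt (fun z : ℂ ↦ I * z) I (t : ℂ) := by
    simpa using (hasDerivAt_id (t : ℂ)).const_mul I
  have h3 : HasDerivAt etaIm (deriv eta (I * t) * I).re t := (h1.comp (t : ℂ) h2).real_of_complex
  have h0 : eta (I * t) ≠ 0 := eta_ne_zero (im_I_mul_ofReal_pos ht)
  refine h3.congr_deriv ?_
  rw [etaImLogDeriv, ← re_mul_ofReal, ofReal_etaIm]
  congr 1
  field_simp

/-- This form exhibits the limit at i∞: the second summand carries a factor q, so only 2πi/24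
survives. -/
theorem deriv_eta_div_eta {z : ℂ} (hz : 0 < z.im) : deriv eta z / eta z = 2 * π * I *
    (1 / 24 + cexp (2 * π * I * z) * (deriv eulerProd (cexp (2 * π * I * z)) /
      eulerProd (cexp (2 * π * I * z)))) := by
  have hq : ‖cexp (2 * π * I * z)‖ < 1 := norm_exp_two_pi_I_lt_one ⟨z, hz⟩
  have h1 : HasDerivAt eulerProd (deriv eulerProd (cexp (2 * π * I * z)))
      (cexp (2 * π * I * z)) :=
    (differentiableOn_tprod_one_sub_pow.differentiableAt
      (Metric.isOpen_ball.mem_nhds (by simpa using hq))).hasDerivAt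
  have h2 : HasDerivAt (fun z : ℂ ↦ cexp (2 * π * I * z))
      (cexp (2 * π * I * z) * (2 * π * I)) z := by
    simpa using ((hasDerivAt_id z).const_mul (2 * π * I)).cexp
  have h3 : HasDerivAt (fun z : ℂ ↦ cexp (2 * π * I * z / 24))
      (cexp (2 * π * I * z / 24) * (2 * π * I / 24)) z := by
    simpa using (((hasDerivAt_id z).const_mul (2 * π * I)).div_const 24).cexp
  have h4 := h3.mul (h1.comp z h2)
  have h5 : eta = (fun z : ℂ ↦ cexp (2 * π * I * z / 24)) *
      (eulerProd ∘ fun z : ℂ ↦ cexp (2 * π * I * z)) := funext eta_eq_exp_mul_eulerProd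
  rw [← h5] at h4
  have h0 : eta z ≠ 0 := eta_ne_zero hz
  rw [eta_eq_exp_mul_eulerProd] at h0
  have h6 := right_ne_zero_of_mul h0
  rw [h4.deriv, eta_eq_exp_mul_eulerProd, Function.comp_apply]
  have h7 := Complex.exp_ne_zero (2 * π * I * z / 24)
  generalize cexp (2 * π * I * z / 24) = x at *
  generalize cexp (2 * π * I * z) = y at *
  field_simp

theorem tendsto_exp_pi_mul_I_atTop :
    Tendsto (fun t : ℝ ↦ cexp (π * I * (I * t))) atTop (𝓝 0) := by
  have h : Tendsto (fun t : ℝ ↦ Real.exp (-(π * t))) atTop (𝓝 0) :=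
    Real.tendsto_exp_atBot.comp
      (tendsto_neg_atTop_atBot.comp (tendsto_id.const_mul_atTop Real.pi_pos))
  have h' := (continuous_ofReal.tendsto 0).comp h
  rw [ofReal_zero] at h'
  refine h'.congr fun t ↦ ?_
  simp only [Function.comp_apply, ofReal_exp]
  congr 1
  push_cast
  linear_combination -π * t * I_sq

theorem tendsto_etaImLogDeriv_atTop : Tendsto etaImLogDeriv atTop (𝓝 (-(π / 12))) := by
  have hq : Tendsto (fun t : ℝ ↦ cexp (2 * π * I * (I * t))) atTop (𝓝 0) := by
    have h := tendsto_exp_pi_mul_I_atTop.pow 2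
    rw [zero_pow two_ne_zero] at h
    refine h.congr fun t ↦ ?_
    rw [← exp_nat_mul]
    congr 1
    push_cast
    ring
  have hd : Tendsto (deriv eulerProd) (𝓝 0) (𝓝 (deriv eulerProd 0)) :=
    ((differentiableOn_tprod_one_sub_pow.deriv Metric.isOpen_ball).differentiableAt
      (Metric.isOpen_ball.mem_nhds (by simp))).continuousAt
  have h1 := (tendsto_id.mul (hd.div tendsto_eulerProd_zero one_ne_zero)).comp hq
  have h2 := ((h1.const_add (1 / 24)).const_mul (2 * π * I)).const_mul I
  have h3 := (Complex.continuous_re.tendsto _).comp h2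
  have he : (I * (2 * π * I * (1 / 24 + 0 * (deriv eulerProd 0 / 1)))).re = -(π / 12) := by
    rw [show I * (2 * π * I * (1 / 24 + 0 * (deriv eulerProd 0 / 1))) = ((-(π / 12) : ℝ) : ℂ) by
      push_cast; linear_combination π / 12 * I_sq, ofReal_re]
  rw [he] at h3
  refine h3.congr' ?_
  filter_upwards [eventually_gt_atTop 0] with t ht
  rw [etaImLogDeriv, deriv_eta_div_eta (im_I_mul_ofReal_pos ht)]
  rfl

/-! ### Real theta functions and duplication formulas -/

/-- `θ₂²` on the imaginary axis. -/
noncomputable def thetaTwoSq (t : ℝ) : ℝ := 4 * etaIm (2 * t) ^ 4 / etaIm t ^ 2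

/-- `θ₃²` on the imaginary axis. -/
noncomputable def thetaThreeSq (t : ℝ) : ℝ :=
  etaIm t ^ 10 / (etaIm (t / 2) ^ 4 * etaIm (2 * t) ^ 4)

/-- `θ₄²` on the imaginary axis. -/
noncomputable def thetaFourSq (t : ℝ) : ℝ := etaIm (t / 2) ^ 4 / etaIm t ^ 2

variable {t : ℝ}

theorem thetaTwoSq_pos (ht : 0 < t) : 0 < thetaTwoSq t := by
  have h1 := etaIm_ne_zero ht
  have h2 : etaIm (2 * t) ≠ 0 := etaIm_ne_zero (by positivity)
  unfold thetaTwoSq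
  positivity

theorem thetaThreeSq_pos (ht : 0 < t) : 0 < thetaThreeSq t := by
  have h1 := etaIm_ne_zero ht
  have h2 : etaIm (2 * t) ≠ 0 := etaIm_ne_zero (by positivity)
  have h3 : etaIm (t / 2) ≠ 0 := etaIm_ne_zero (by positivity)
  unfold thetaThreeSq
  positivity

theorem thetaFourSq_pos (ht : 0 < t) : 0 < thetaFourSq t := by
  have h1 := etaIm_ne_zero ht
  have h3 : etaIm (t / 2) ≠ 0 := etaIm_ne_zero (by positivity)
  unfold thetaFourSq
  positivity

theorem ofReal_thetaTwoSq_sq (t : ℝ) : ((thetaTwoSq t ^ 2 : ℝ) : ℂ) = thetaTwoPow (I * t) := by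
  have h : eta (2 * (I * t)) = etaIm (2 * t) := by
    rw [ofReal_etaIm]
    push_cast
    congr 1
    ring
  rw [thetaTwoSq, thetaTwoPow, h, ← ofReal_etaIm]
  push_cast
  ring

theorem ofReal_thetaFourSq_sq (t : ℝ) : ((thetaFourSq t ^ 2 : ℝ) : ℂ) = thetaFourPow (I * t) := by
  have h : eta (I * t / 2) = etaIm (t / 2) := by
    rw [ofReal_etaIm]
    push_cast
    congr 1
    ring
  rw [thetaFourSq, thetaFourPow, h, ← ofReal_etaIm]
  push_cast
  ring

theorem ofReal_thetaThreeSq_sq (ht : 0 < t) :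
    ((thetaThreeSq t ^ 2 : ℝ) : ℂ) = thetaThreePow (I * t) := by
  have h : eta (I * t / 2) = etaIm (t / 2) := by
    rw [ofReal_etaIm]
    push_cast
    congr 1
    ring
  have h' : eta (2 * (I * t)) = etaIm (2 * t) := by
    rw [ofReal_etaIm]
    push_cast
    congr 1
    ring
  rw [thetaThreeSq, thetaThreePow_eq (im_I_mul_ofReal_pos ht), h, h', ← ofReal_etaIm]
  push_cast
  ring

theorem thetaTwoSq_sq_add_thetaFourSq_sq (ht : 0 < t) :
    thetaTwoSq t ^ 2 + thetaFourSq t ^ 2 = thetaThreeSq t ^ 2 := by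
  have h := thetaTwoPow_add_thetaFourPow (im_I_mul_ofReal_pos ht)
  rw [← ofReal_thetaTwoSq_sq, ← ofReal_thetaFourSq_sq, ← ofReal_thetaThreeSq_sq ht] at h
  exact_mod_cast h

theorem thetaTwoSq_sq_eq (ht : 0 < t) :
    thetaTwoSq t ^ 2 = 4 * (thetaTwoSq (2 * t) * thetaThreeSq (2 * t)) := by
  have h1 := etaIm_ne_zero ht
  have h2 : etaIm (2 * t) ≠ 0 := etaIm_ne_zero (by positivity)
  have h3 : etaIm (2 * (2 * t)) ≠ 0 := etaIm_ne_zero (by positivity)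
  rw [thetaTwoSq, thetaTwoSq, thetaThreeSq, mul_div_cancel_left₀ t two_ne_zero]
  generalize etaIm (2 * (2 * t)) = x at *
  generalize etaIm (2 * t) = y at *
  field_simp

theorem thetaThreeSq_mul_thetaFourSq (ht : 0 < t) :
    thetaThreeSq t * thetaFourSq t = thetaFourSq (2 * t) ^ 2 := by
  have h1 := etaIm_ne_zero ht
  have h2 : etaIm (2 * t) ≠ 0 := etaIm_ne_zero (by positivity)
  have h3 : etaIm (t / 2) ≠ 0 := etaIm_ne_zero (by positivity)
  rw [thetaFourSq, thetaFourSq, thetaThreeSq, mul_div_cancel_left₀ t two_ne_zero]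
  generalize etaIm (2 * t) = y at *
  field_simp

/-- With a = θ₃²(2t) and b = θ₂²(2t), the eta quotients and Jacobi's identity give θ₃⁴ - θ₄⁴ = 4ab
and θ₃²θ₄² = a² - b² at t. Hence θ₃⁴ + θ₄⁴ = 2(a² + b²) by positivity, and θ₃⁴ = (a + b)². -/
theorem thetaThreeSq_eq_add (ht : 0 < t) :
    thetaThreeSq t = thetaThreeSq (2 * t) + thetaTwoSq (2 * t) := by
  have ht2 : 0 < 2 * t := by positivity
  have h1 := thetaTwoSq_sq_add_thetaFourSq_sq ht
  have h2 := thetaTwoSq_sq_add_thetaFourSq_sq ht2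
  have h3 := thetaTwoSq_sq_eq ht
  have h4 := thetaThreeSq_mul_thetaFourSq ht
  have p1 := thetaThreeSq_pos ht
  have p2 := thetaThreeSq_pos ht2
  have p3 := thetaTwoSq_pos ht2
  have p4 := thetaFourSq_pos ht
  have h5 : (thetaThreeSq t ^ 2 + thetaFourSq t ^ 2) ^ 2 =
      (2 * (thetaThreeSq (2 * t) ^ 2 + thetaTwoSq (2 * t) ^ 2)) ^ 2 := by
    have e1 : thetaThreeSq t ^ 2 - thetaFourSq t ^ 2 =
        4 * (thetaTwoSq (2 * t) * thetaThreeSq (2 * t)) := by linarith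
    have e2 : thetaThreeSq t * thetaFourSq t =
        thetaThreeSq (2 * t) ^ 2 - thetaTwoSq (2 * t) ^ 2 := by linarith
    calc _ = (thetaThreeSq t ^ 2 - thetaFourSq t ^ 2) ^ 2 +
          4 * (thetaThreeSq t * thetaFourSq t) ^ 2 := by ring
      _ = _ := by rw [e1, e2]; ring
  rw [sq_eq_sq₀ (by positivity) (by positivity)] at h5
  refine (sq_eq_sq₀ (by positivity) (by positivity)).mp ?_
  linarith

theorem thetaFourSq_eq_sub (ht : 0 < t) :
    thetaFourSq t = thetaThreeSq (2 * t) - thetaTwoSq (2 * t) := by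
  have h2 := thetaTwoSq_sq_add_thetaFourSq_sq (show 0 < 2 * t by positivity)
  have h4 := thetaThreeSq_mul_thetaFourSq ht
  have h5 := thetaThreeSq_eq_add ht
  refine mul_left_cancel₀ (thetaThreeSq_pos ht).ne' ?_
  rw [h4]
  nth_rw 1 [h5]
  linarith

/-! ### The elliptic modulus and its differential equation -/

/-- The elliptic modulus `k = θ₂² / θ₃²` on the imaginary axis. -/
noncomputable def ellipticModulus (t : ℝ) : ℝ := thetaTwoSq t / thetaThreeSq t

/-- The logarithmic derivative of `ellipticModulus`. -/
noncomputable def ellipticModulusLogDeriv (t : ℝ) : ℝ :=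
  16 * etaImLogDeriv (2 * t) + 2 * etaImLogDeriv (t / 2) - 12 * etaImLogDeriv t

theorem ellipticModulus_pos (ht : 0 < t) : 0 < ellipticModulus t :=
  div_pos (thetaTwoSq_pos ht) (thetaThreeSq_pos ht)

/-- Here k = 4η(2t)⁸η(t/2)⁴/η(t)¹²; the coefficients 16, 2, -12 are the exponents times the chain
rule factors 2, 1/2, 1. -/
theorem hasDerivAt_ellipticModulus (ht : 0 < t) :
    HasDerivAt ellipticModulus (ellipticModulusLogDeriv t * ellipticModulus t) t := by
  have h1 := hasDerivAt_etaIm ht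
  have h2 : HasDerivAt (fun s ↦ etaIm (2 * s)) (etaImLogDeriv (2 * t) * etaIm (2 * t) * 2) t := by
    have := (hasDerivAt_etaIm (show 0 < 2 * t by positivity)).comp t
      ((hasDerivAt_id t).const_mul 2)
    simpa [Function.comp_def] using this
  have h3 : HasDerivAt (fun s ↦ etaIm (s / 2)) (etaImLogDeriv (t / 2) * etaIm (t / 2) / 2) t := by
    have := (hasDerivAt_etaIm (show 0 < t / 2 by positivity)).comp t
      ((hasDerivAt_id t).div_const 2)
    simpa [Function.comp_def, div_eq_mul_inv] using this
  have n1 := etaIm_ne_zero ht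
  have n2 : etaIm (2 * t) ≠ 0 := etaIm_ne_zero (by positivity)
  have n3 : etaIm (t / 2) ≠ 0 := etaIm_ne_zero (by positivity)
  have h4 := (((h2.pow 4).const_mul 4).div (h1.pow 2) (pow_ne_zero _ n1)).div
    ((h1.pow 10).div ((h3.pow 4).mul (h2.pow 4)) (mul_ne_zero (pow_ne_zero _ n3)
      (pow_ne_zero _ n2))) (div_ne_zero (pow_ne_zero _ n1)
        (mul_ne_zero (pow_ne_zero _ n3) (pow_ne_zero _ n2)))
  refine HasDerivAt.congr_deriv (f := ellipticModulus) h4 ?_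
  simp only [ellipticModulus, ellipticModulusLogDeriv, thetaTwoSq, thetaThreeSq, Pi.pow_apply,
    Pi.mul_apply, Pi.div_apply]
  generalize etaImLogDeriv (2 * t) = l2
  generalize etaIm (2 * t) = e2 at *
  generalize etaImLogDeriv (t / 2) = l3
  generalize etaIm (t / 2) = e3 at *
  generalize etaIm t = e1 at *
  generalize etaImLogDeriv t = l1
  clear h1 h2 h3 h4
  push_cast
  field_simp
  ring

/-- Landen's transformation, the quotient of the duplication formulas for θ₂⁴ and θ₃². -/
theorem ellipticModulus_sq (ht : 0 < t) : ellipticModulus t ^ 2 =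
    4 * ellipticModulus (2 * t) / (1 + ellipticModulus (2 * t)) ^ 2 := by
  have ht2 : 0 < 2 * t := by positivity
  have p2 := thetaThreeSq_pos ht2
  have p3 := thetaTwoSq_pos ht2
  rw [ellipticModulus, ellipticModulus, div_pow, thetaTwoSq_sq_eq ht, thetaThreeSq_eq_add ht]
  generalize thetaThreeSq (2 * t) = x at *
  generalize thetaTwoSq (2 * t) = y at *
  field_simp

/-- The logarithmic derivative of Landen's transformation: 4x/(1 + x)² contributes (1 - x)/(1 + x),
which at x = k(2t) is θ₄²/θ₃² at t. -/
theorem ellipticModulusLogDeriv_eq (ht : 0 < t) : ellipticModulusLogDeriv t =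
    ellipticModulusLogDeriv (2 * t) * (thetaFourSq t / thetaThreeSq t) := by
  have ht2 : 0 < 2 * t := by positivity
  have h1 := (hasDerivAt_ellipticModulus ht).pow 2
  have h2 : HasDerivAt (fun s ↦ ellipticModulus (2 * s))
      (ellipticModulusLogDeriv (2 * t) * ellipticModulus (2 * t) * 2) t := by
    have := (hasDerivAt_ellipticModulus ht2).comp t ((hasDerivAt_id t).const_mul 2)
    simpa [Function.comp_def] using this
  have p0 := ellipticModulus_pos ht
  have p := ellipticModulus_pos ht2
  have h3 := (h2.const_mul 4).div ((h2.const_add 1).pow 2) (pow_ne_zero 2 (by positivity))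
  have h4 := h3.congr_of_eventuallyEq (f₁ := ellipticModulus ^ 2) (by
    filter_upwards [eventually_gt_nhds ht] with s hs
    simpa using ellipticModulus_sq hs)
  have h5 := h1.unique h4
  have h6 : thetaFourSq t / thetaThreeSq t =
      (1 - ellipticModulus (2 * t)) / (1 + ellipticModulus (2 * t)) := by
    have p2 := thetaThreeSq_pos ht2
    have p3 := thetaTwoSq_pos ht2
    rw [thetaThreeSq_eq_add ht, thetaFourSq_eq_sub ht, ellipticModulus]
    generalize thetaThreeSq (2 * t) = x at *
    generalize thetaTwoSq (2 * t) = y at *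
    field_simp
  have h7 := ellipticModulus_sq ht
  have h8 : (ellipticModulus t ^ 2) * ellipticModulusLogDeriv t * 2 =
      4 * ellipticModulus (2 * t) / (1 + ellipticModulus (2 * t)) ^ 2 *
        (ellipticModulusLogDeriv (2 * t) *
          ((1 - ellipticModulus (2 * t)) / (1 + ellipticModulus (2 * t)))) * 2 := by
    simp only [Pi.pow_apply] at h5
    push_cast at h5
    calc _ = _ := by ring
      _ = _ := h5
      _ = _ := by
        generalize ellipticModulus (2 * t) = x at *
        generalize ellipticModulusLogDeriv (2 * t) = y at *
        clear h1 h2 h3 h4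
        field_simp
        ring
  rw [← h7] at h8
  rw [h6]
  have h9 := mul_right_cancel₀ two_ne_zero h8
  exact mul_left_cancel₀ (pow_ne_zero 2 p0.ne') h9

theorem tendsto_thetaFourSq_sq_atTop : Tendsto (fun t ↦ thetaFourSq t ^ 2) atTop (𝓝 1) := by
  have h := ((tendsto_eulerProd_zero.comp tendsto_exp_pi_mul_I_atTop).pow 8).div
    ((tendsto_eulerProd_zero.comp
      (by simpa using tendsto_exp_pi_mul_I_atTop.pow 2 :
        Tendsto (fun t : ℝ ↦ cexp (π * I * (I * t)) ^ 2) atTop (𝓝 0))).pow 4) (by simp)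
  have h' := (Complex.continuous_re.tendsto _).comp h
  simp only [one_pow, div_one, one_re] at h'
  refine h'.congr fun t ↦ ?_
  have e := thetaFourPow_eq_eulerProd (I * t)
  rw [← ofReal_thetaFourSq_sq] at e
  simp only [Function.comp_apply]
  exact (congrArg Complex.re e).symm.trans (ofReal_re _)

theorem tendsto_ellipticModulusLogDeriv_atTop :
    Tendsto ellipticModulusLogDeriv atTop (𝓝 (-(π / 2))) := by
  have h := tendsto_etaImLogDeriv_atTop
  have h1 := h.comp (tendsto_id.const_mul_atTop (two_pos (α := ℝ)))
  have h2 := h.comp (tendsto_id.atTop_div_const (two_pos (α := ℝ)))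
  have h3 := ((h1.const_mul 16).add (h2.const_mul 2)).sub (h.const_mul 12)
  rw [show -(π / 2) = 16 * -(π / 12) + 2 * -(π / 12) - 12 * -(π / 12) by ring]
  exact h3

theorem ellipticModulusLogDeriv_div_eq (ht : 0 < t) :
    ellipticModulusLogDeriv t / thetaFourSq t ^ 2 =
      ellipticModulusLogDeriv (2 * t) / thetaFourSq (2 * t) ^ 2 := by
  have p1 := thetaThreeSq_pos ht
  have p2 := thetaFourSq_pos ht
  rw [← thetaThreeSq_mul_thetaFourSq ht, ellipticModulusLogDeriv_eq ht]
  field_simp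

/-- The quotient by θ₄⁴ is constant along t, 2t, 4t, …, so it equals its limit at infinity. -/
theorem ellipticModulusLogDeriv_eq_neg (ht : 0 < t) :
    ellipticModulusLogDeriv t = -(π / 2) * thetaFourSq t ^ 2 := by
  have h1 : ∀ n : ℕ, ellipticModulusLogDeriv (2 ^ n * t) / thetaFourSq (2 ^ n * t) ^ 2 =
      ellipticModulusLogDeriv t / thetaFourSq t ^ 2 := by
    intro n
    induction n with
    | zero => simp
    | succ n ih =>
      rw [← ih, ellipticModulusLogDeriv_div_eq (t := 2 ^ n * t) (by positivity), pow_succ',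
        mul_assoc]
  have h2 : Tendsto (fun n : ℕ ↦ (2 : ℝ) ^ n * t) atTop atTop :=
    (tendsto_pow_atTop_atTop_of_one_lt one_lt_two).atTop_mul_const ht
  have h3 := ((tendsto_ellipticModulusLogDeriv_atTop.div tendsto_thetaFourSq_sq_atTop
    one_ne_zero).comp h2)
  have h4 := tendsto_nhds_unique h3 ((tendsto_const_nhds).congr fun n ↦ (h1 n).symm)
  rw [div_one] at h4
  rw [h4, div_mul_cancel₀ _ (pow_ne_zero 2 (thetaFourSq_pos ht).ne')]

/-! ### The substitution x = k² and the beta integral -/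

theorem ellipticModulus_eq (ht : 0 < t) :
    ellipticModulus t = 4 * etaIm (2 * t) ^ 8 * etaIm (t / 2) ^ 4 / etaIm t ^ 12 := by
  have n1 := etaIm_ne_zero ht
  have n2 : etaIm (2 * t) ≠ 0 := etaIm_ne_zero (by positivity)
  have n3 : etaIm (t / 2) ≠ 0 := etaIm_ne_zero (by positivity)
  rw [ellipticModulus, thetaTwoSq, thetaThreeSq]
  generalize etaIm (2 * t) = e2 at *
  field_simp

theorem one_sub_ellipticModulus_sq (ht : 0 < t) :
    1 - ellipticModulus t ^ 2 = (thetaFourSq t / thetaThreeSq t) ^ 2 := by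
  have h := thetaTwoSq_sq_add_thetaFourSq_sq ht
  have h0 := (thetaThreeSq_pos ht).ne'
  rw [ellipticModulus]
  field_simp
  linarith

theorem ellipticModulus_sq_mem_Ioo (ht : 0 < t) : ellipticModulus t ^ 2 ∈ Set.Ioo (0 : ℝ) 1 := by
  have h := one_sub_ellipticModulus_sq ht
  have h0 := ellipticModulus_pos ht
  have h1 : 0 < (thetaFourSq t / thetaThreeSq t) ^ 2 :=
    pow_pos (div_pos (thetaFourSq_pos ht) (thetaThreeSq_pos ht)) 2
  exact ⟨by positivity, by linarith⟩

theorem hasDerivAt_ellipticModulus_sq (ht : 0 < t) : HasDerivAt (fun t ↦ ellipticModulus t ^ 2)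
    (-(π * thetaFourSq t ^ 2 * ellipticModulus t ^ 2)) t := by
  refine ((hasDerivAt_ellipticModulus ht).pow 2).congr_deriv ?_
  rw [ellipticModulusLogDeriv_eq_neg ht]
  push_cast
  ring

/-- Inversion interchanges θ₂⁴ and θ₄⁴ and fixes θ₃⁴, up to a common factor. The behaviour of k² at
0 thus follows from that at infinity. -/
theorem ellipticModulus_sq_inv (ht : 0 < t) :
    ellipticModulus t⁻¹ ^ 2 = 1 - ellipticModulus t ^ 2 := by
  have him := im_I_mul_ofReal_pos ht
  have e : I * ((t⁻¹ : ℝ) : ℂ) = -1 / (I * t) := by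
    have : (t : ℂ) ≠ 0 := ofReal_ne_zero.mpr ht.ne'
    push_cast
    field_simp
    exact I_sq
  have e2 : -(I * (t : ℂ)) ^ 2 = ((t ^ 2 : ℝ) : ℂ) := by
    push_cast
    linear_combination -(t : ℂ) ^ 2 * I_sq
  have h2 := thetaTwoPow_neg_one_div him
  have h3 := thetaThreePow_neg_one_div him
  rw [← e, ← ofReal_thetaTwoSq_sq, ← ofReal_thetaFourSq_sq, e2] at h2
  rw [← e, ← ofReal_thetaThreeSq_sq (inv_pos.mpr ht), ← ofReal_thetaThreeSq_sq ht, e2] at h3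
  norm_cast at h2 h3
  rw [one_sub_ellipticModulus_sq ht, ellipticModulus, div_pow, h2, h3, div_pow,
    mul_div_mul_left _ _ (pow_ne_zero 2 ht.ne')]

theorem tendsto_thetaTwoSq_sq_atTop : Tendsto (fun t ↦ thetaTwoSq t ^ 2) atTop (𝓝 0) := by
  have hx := tendsto_exp_pi_mul_I_atTop
  have hp : ∀ n : ℕ, n ≠ 0 →
      Tendsto (fun t : ℝ ↦ eulerProd (cexp (π * I * (I * t)) ^ n)) atTop (𝓝 1) := fun n hn ↦
    tendsto_eulerProd_zero.comp (by simpa [hn] using hx.pow n)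
  have h := ((hx.const_mul 16).mul ((hp 4 (by simp)).pow 8)).div ((hp 2 (by simp)).pow 4) (by simp)
  have h' := (Complex.continuous_re.tendsto _).comp h
  simp only [mul_zero, zero_mul, zero_div, zero_re] at h'
  refine h'.congr fun t ↦ ?_
  have e := thetaTwoPow_eq_eulerProd (I * t)
  rw [← ofReal_thetaTwoSq_sq] at e
  exact (congrArg Complex.re e).symm.trans (ofReal_re _)

theorem tendsto_ellipticModulus_sq_atTop :
    Tendsto (fun t ↦ ellipticModulus t ^ 2) atTop (𝓝 0) := by
  have h := tendsto_thetaTwoSq_sq_atTop.div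
    (tendsto_thetaTwoSq_sq_atTop.add tendsto_thetaFourSq_sq_atTop) (by simp)
  rw [zero_div] at h
  refine h.congr' ?_
  filter_upwards [eventually_gt_atTop 0] with t ht
  simp only [Pi.div_apply]
  rw [thetaTwoSq_sq_add_thetaFourSq_sq ht, ellipticModulus, div_pow]

theorem injOn_ellipticModulus_sq : Set.InjOn (fun t ↦ ellipticModulus t ^ 2) (Set.Ioi 0) := by
  refine (strictAntiOn_of_deriv_neg (convex_Ioi 0) (fun t ht ↦
    (hasDerivAt_ellipticModulus_sq ht).continuousAt.continuousWithinAt) fun t ht ↦ ?_).injOn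
  rw [interior_Ioi] at ht
  rw [(hasDerivAt_ellipticModulus_sq ht).deriv]
  have h1 := thetaFourSq_pos ht
  have h2 := ellipticModulus_pos ht
  have : 0 < π * thetaFourSq t ^ 2 * ellipticModulus t ^ 2 := by positivity
  linarith

theorem image_ellipticModulus_sq :
    (fun t ↦ ellipticModulus t ^ 2) '' Set.Ioi 0 = Set.Ioo (0 : ℝ) 1 := by
  refine Set.Subset.antisymm ?_ fun y hy ↦ ?_
  · rintro _ ⟨t, ht, rfl⟩
    exact ellipticModulus_sq_mem_Ioo ht
  · obtain ⟨a, ha, ha0⟩ := ((tendsto_ellipticModulus_sq_atTop.eventually_lt_const hy.1).and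
      (eventually_gt_atTop 0)).exists
    obtain ⟨b, hb, hb0⟩ := ((tendsto_ellipticModulus_sq_atTop.eventually_lt_const
      (sub_pos.mpr hy.2)).and (eventually_gt_atTop 0)).exists
    refine isPreconnected_Ioi.intermediate_value (a := a) (b := b⁻¹) ha0 (inv_pos.mpr hb0)
      (fun t ht ↦ (hasDerivAt_ellipticModulus_sq ht).continuousAt.continuousWithinAt)
      ⟨ha.le, ?_⟩
    rw [ellipticModulus_sq_inv hb0]
    linarith

theorem deriv_mul_beta_integrand_eq (ht : 0 < t) :
    π * thetaFourSq t ^ 2 * ellipticModulus t ^ 2 *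
      ((ellipticModulus t ^ 2) ^ (-(1 / 2) : ℝ) * (1 - ellipticModulus t ^ 2) ^ (-(3 / 4) : ℝ)) =
      4 * π * (etaIm t ^ 2 * etaIm (2 * t) ^ 2) := by
  have n1 := etaIm_ne_zero ht
  have n2 : etaIm (2 * t) ≠ 0 := etaIm_ne_zero (by positivity)
  have n3 : etaIm (t / 2) ≠ 0 := etaIm_ne_zero (by positivity)
  have hk := ellipticModulus_pos ht
  -- The square root of the complementary modulus θ₄²/θ₃²: as 1 - k² = r⁴ with r > 0, the power -3/4
  -- becomes r⁻³.
  set r := etaIm (t / 2) ^ 4 * etaIm (2 * t) ^ 2 / etaIm t ^ 6 with hr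
  have hr0 : 0 < r := by positivity
  have h1 : 1 - ellipticModulus t ^ 2 = r ^ 4 := by
    rw [one_sub_ellipticModulus_sq ht, hr, thetaFourSq, thetaThreeSq]
    generalize etaIm (2 * t) = e2 at *
    field_simp
  have h2 : (r ^ 4) ^ (-(3 / 4) : ℝ) = (r ^ 3)⁻¹ := by
    rw [← Real.rpow_natCast, ← Real.rpow_natCast, ← Real.rpow_mul hr0.le, ← Real.rpow_neg hr0.le]
    norm_num
  have h3 : (ellipticModulus t ^ 2) ^ (-(1 / 2) : ℝ) = (ellipticModulus t)⁻¹ := by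
    rw [← Real.rpow_natCast, ← Real.rpow_mul hk.le, ← Real.rpow_neg_one]
    norm_num
  rw [h1, h2, h3, show π * thetaFourSq t ^ 2 * ellipticModulus t ^ 2 *
    ((ellipticModulus t)⁻¹ * (r ^ 3)⁻¹) = π * thetaFourSq t ^ 2 * ellipticModulus t * (r ^ 3)⁻¹ by
      field_simp, ellipticModulus_eq ht, hr, thetaFourSq]
  clear h1 h2 h3 hr hr0 r hk
  generalize etaIm (2 * t) = e2 at *
  field_simp

theorem integral_beta_integrand_eq :
    ∫ x in Set.Ioo (0 : ℝ) 1, x ^ (-(1 / 2) : ℝ) * (1 - x) ^ (-(3 / 4) : ℝ) =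
      4 * π * ∫ t in Set.Ioi (0 : ℝ), etaIm t ^ 2 * etaIm (2 * t) ^ 2 := by
  rw [← image_ellipticModulus_sq, MeasureTheory.integral_image_eq_integral_abs_deriv_smul
    measurableSet_Ioi (fun t ht ↦ (hasDerivAt_ellipticModulus_sq ht).hasDerivWithinAt)
    injOn_ellipticModulus_sq, ← MeasureTheory.integral_const_mul]
  refine MeasureTheory.setIntegral_congr_fun measurableSet_Ioi fun t ht ↦ ?_
  have h1 := thetaFourSq_pos ht
  have h2 := ellipticModulus_pos ht
  simp only [abs_neg, smul_eq_mul]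
  rw [abs_of_pos (by positivity), deriv_mul_beta_integrand_eq ht]

theorem betaIntegral_half_quarter_eq_integral : betaIntegral (1 / 2) (1 / 4) =
    ((∫ x in Set.Ioo (0 : ℝ) 1, x ^ (-(1 / 2) : ℝ) * (1 - x) ^ (-(3 / 4) : ℝ) : ℝ) : ℂ) := by
  rw [betaIntegral, intervalIntegral.integral_of_le zero_le_one,
    MeasureTheory.integral_Ioc_eq_integral_Ioo, ← integral_complex_ofReal]
  refine MeasureTheory.setIntegral_congr_fun measurableSet_Ioo fun x hx ↦ ?_
  simp only [ofReal_mul]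
  rw [ofReal_cpow hx.1.le, ofReal_cpow (sub_nonneg.mpr hx.2.le)]
  push_cast
  norm_num

theorem integral_etaSqProd :
    ∫ t in Set.Ioi (0 : ℝ), etaSqProd (I * t) = betaIntegral (1 / 2) (1 / 4) / (4 * π) := by
  have h : ∫ t in Set.Ioi (0 : ℝ), etaSqProd (I * t) =
      ((∫ t in Set.Ioi (0 : ℝ), etaIm t ^ 2 * etaIm (2 * t) ^ 2 : ℝ) : ℂ) := by
    rw [← integral_complex_ofReal]
    refine MeasureTheory.setIntegral_congr_fun measurableSet_Ioi fun t ht ↦ ?_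
    simp only [ofReal_mul, ofReal_pow, ofReal_etaIm, etaSqProd]
    congr 3
    push_cast
    ring
  have hpi : (π : ℂ) ≠ 0 := ofReal_ne_zero.mpr Real.pi_ne_zero
  rw [h, betaIntegral_half_quarter_eq_integral, integral_beta_integrand_eq]
  push_cast
  field_simp

theorem L_etaCuspForm_one :
    L two_pos etaCuspForm 1 = betaIntegral (1 / 2) (1 / 4) / 8 := by
  have hpi : (π : ℂ) ≠ 0 := ofReal_ne_zero.mpr Real.pi_ne_zero
  rw [L_etaCuspForm_one_eq_integral, integral_etaSqProd]
  field_simp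
  ring

end ModularForm

/-! ### Arithmetic of ℚ(i) and its Chowla-Selberg number -/

theorem rationalsAdjoinSqrtNeg_four_eq : rationalsAdjoinSqrtNeg 4 = ℚ⟮I⟯ := by
  have h : Real.sqrt ((4 : ℕ) : ℝ) = 2 := by
    rw [show ((4 : ℕ) : ℝ) = 2 ^ 2 by norm_num, Real.sqrt_sq two_pos.le]
  rw [rationalsAdjoinSqrtNeg, h]
  apply le_antisymm
  · rw [IntermediateField.adjoin_simple_le_iff]
    exact mul_mem (IntermediateField.mem_adjoin_simple_self ℚ I)
      (by exact_mod_cast (ofNat_mem (ℚ⟮I⟯) 2 : ((OfNat.ofNat 2 : ℂ)) ∈ ℚ⟮I⟯))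
  · rw [IntermediateField.adjoin_simple_le_iff]
    have h1 := IntermediateField.mem_adjoin_simple_self ℚ (I * ((2 : ℝ) : ℂ))
    have h2 := div_mem h1 (ofNat_mem (ℚ⟮(I * ((2 : ℝ) : ℂ))⟯) 2 : ((OfNat.ofNat 2 : ℂ)) ∈ _)
    simpa using h2

instance isCyclotomicExtension_rationalsAdjoinSqrtNeg_four :
    IsCyclotomicExtension {4} ℚ (rationalsAdjoinSqrtNeg 4) := by
  have h : IsAlgebraic ℚ I := (isPrimitiveRoot_I.isIntegral four_pos).tower_top.isAlgebraic
  rw [rationalsAdjoinSqrtNeg_four_eq]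
  change IsCyclotomicExtension {4} ℚ ℚ⟮I⟯.toSubalgebra
  rw [IntermediateField.adjoin_simple_toSubalgebra_of_isAlgebraic h]
  exact isPrimitiveRoot_I.adjoin_isCyclotomicExtension ℚ

theorem discr_rationalsAdjoinSqrtNeg_four :
    NumberField.discr (rationalsAdjoinSqrtNeg 4) = -4 := by
  have : Fact (Nat.Prime 2) := ⟨Nat.prime_two⟩
  have : IsCyclotomicExtension {2 ^ (1 + 1)} ℚ (rationalsAdjoinSqrtNeg 4) :=
    isCyclotomicExtension_rationalsAdjoinSqrtNeg_four
  rw [IsCyclotomicExtension.Rat.discr_prime_pow_succ 2 1 (rationalsAdjoinSqrtNeg 4)]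
  norm_num

theorem torsionOrder_rationalsAdjoinSqrtNeg_four :
    NumberField.Units.torsionOrder (rationalsAdjoinSqrtNeg 4) = 4 := by
  rw [IsCyclotomicExtension.Rat.torsionOrder_eq (n := 4)]
  decide

theorem classNumber_rationalsAdjoinSqrtNeg_four :
    NumberField.classNumber (rationalsAdjoinSqrtNeg 4) = 1 := by
  rw [NumberField.classNumber_eq_one_iff]
  apply RingOfIntegers.isPrincipalIdealRing_of_abs_discr_lt
  rw [discr_rationalsAdjoinSqrtNeg_four]
  rw [IsCyclotomicExtension.finrank (n := 4) (rationalsAdjoinSqrtNeg 4)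
    (Polynomial.cyclotomic.irreducible_rat (by norm_num)),
    IsCyclotomicExtension.Rat.nrComplexPlaces_eq_totient_div_two 4,
    show Nat.totient 4 = 2 by decide]
  norm_num
  -- Minkowski's criterion reduces here to 4 < π².
  nlinarith [Real.pi_gt_three]

theorem kroneckerSymbol_neg_four_one : kroneckerSymbol (-4) 1 = 1 := by
  simp [kroneckerSymbol]

theorem kroneckerSymbol_neg_four_two : kroneckerSymbol (-4) 2 = 0 := by
  have h : padicValNat 2 2 = 1 := padicValNat_self
  rw [kroneckerSymbol, h, show ZMod.χ₈ ((-4 : ℤ) : ZMod 8) = 0 by decide]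
  simp

theorem kroneckerSymbol_neg_four_three : kroneckerSymbol (-4) 3 = -1 := by
  have h : padicValNat 2 3 = 0 := padicValNat.eq_zero_of_not_dvd (by norm_num)
  rw [kroneckerSymbol, h]
  norm_num

theorem chowlaSelbergNumber_rationalsAdjoinSqrtNeg_four :
    chowlaSelbergNumber (rationalsAdjoinSqrtNeg 4) =
      Real.Gamma (1 / 2) * (Real.Gamma (1 / 4) / Real.Gamma (3 / 4)) := by
  rw [chowlaSelbergNumber, discr_rationalsAdjoinSqrtNeg_four,
    torsionOrder_rationalsAdjoinSqrtNeg_four, classNumber_rationalsAdjoinSqrtNeg_four,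
    show Finset.Ioo 0 (-4 : ℤ).natAbs = {1, 2, 3} from by decide]
  have h3 : 0 < Real.Gamma (3 / 4) := Real.Gamma_pos_of_pos (by norm_num)
  rw [Finset.prod_insert (by decide), Finset.prod_insert (by decide), Finset.prod_singleton,
    kroneckerSymbol_neg_four_one, kroneckerSymbol_neg_four_two, kroneckerSymbol_neg_four_three]
  rw [show (((4 : ℕ) : ℝ) * ((1 : ℤ) : ℝ) / (4 * ((1 : ℕ) : ℝ))) = 1 by norm_num,
    show (((4 : ℕ) : ℝ) * ((0 : ℤ) : ℝ) / (4 * ((1 : ℕ) : ℝ))) = 0 by norm_num,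
    show (((4 : ℕ) : ℝ) * ((-1 : ℤ) : ℝ) / (4 * ((1 : ℕ) : ℝ))) = -1 by norm_num,
    Real.rpow_one, Real.rpow_zero, Real.rpow_neg_one, one_mul, div_eq_mul_inv (Real.Gamma _)]
  norm_num

/-! ### Gamma and beta values -/

theorem realGamma_quarter_mul_three_quarters :
    Real.Gamma (1 / 4) * Real.Gamma (3 / 4) = π * Real.sqrt 2 := by
  have h := Real.Gamma_mul_Gamma_one_sub (1 / 4)
  rw [show (1 : ℝ) - 1 / 4 = 3 / 4 by norm_num, show π * (1 / 4) = π / 4 by ring,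
    Real.sin_pi_div_four] at h
  rw [h, div_div_eq_mul_div, div_eq_iff (by positivity), mul_assoc, Real.mul_self_sqrt two_pos.le]

theorem betaIntegral_eq_ofReal_Gamma {a b : ℝ} (ha : 0 < a) (hb : 0 < b) :
    betaIntegral a b = ((Real.Gamma a * Real.Gamma b / Real.Gamma (a + b) : ℝ) : ℂ) := by
  have h := Gamma_mul_Gamma_eq_betaIntegral (s := a) (t := b) (by simpa) (by simpa)
  rw [← ofReal_add, Complex.Gamma_ofReal, Complex.Gamma_ofReal, Complex.Gamma_ofReal] at h
  have h0 : (Real.Gamma (a + b) : ℂ) ≠ 0 :=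
    ofReal_ne_zero.mpr (Real.Gamma_pos_of_pos (by positivity)).ne'
  push_cast
  rw [h, mul_div_cancel_left₀ _ h0]

theorem betaIntegral_half_quarter : betaIntegral (1 / 2) (1 / 4) =
    ((Real.Gamma (1 / 2) * (Real.Gamma (1 / 4) / Real.Gamma (3 / 4)) : ℝ) : ℂ) := by
  have h := betaIntegral_eq_ofReal_Gamma (a := 1 / 2) (b := 1 / 4) (by norm_num) (by norm_num)
  rw [show (1 / 2 + 1 / 4 : ℝ) = 3 / 4 by norm_num, mul_div_assoc] at h
  rw [← h]
  push_cast
  rfl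

/-- In gamma values, with 8·2^(-7/2) = 1/√2 and Γ(1/2)² = π, this is the reflection formula
Γ(1/4)Γ(3/4) = π√2. -/
theorem betaIntegral_half_quarter_eq : betaIntegral (1 / 2) (1 / 4) =
    8 * (((2 : ℝ) ^ (-(7 / 2) : ℝ) : ℝ) : ℂ) * betaIntegral (1 / 4) (1 / 4) := by
  have h := betaIntegral_eq_ofReal_Gamma (a := 1 / 4) (b := 1 / 4) (by norm_num) (by norm_num)
  rw [show (1 / 4 + 1 / 4 : ℝ) = 1 / 2 by norm_num] at h
  push_cast at h
  rw [h, betaIntegral_half_quarter]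
  have h3 : Real.Gamma (3 / 4) ≠ 0 := (Real.Gamma_pos_of_pos (by norm_num)).ne'
  have h4 : Real.Gamma (1 / 4) ≠ 0 := (Real.Gamma_pos_of_pos (by norm_num)).ne'
  have h2 : Real.Gamma (1 / 2) ^ 2 = π := by
    rw [Real.Gamma_one_half_eq, Real.sq_sqrt Real.pi_pos.le]
  have h20 : Real.Gamma (1 / 2) ≠ 0 := (Real.Gamma_pos_of_pos (by norm_num)).ne'
  have hp : (2 : ℝ) ^ (-(7 / 2) : ℝ) = (8 * Real.sqrt 2)⁻¹ := by
    rw [Real.rpow_neg two_pos.le, show (7 / 2 : ℝ) = (3 : ℕ) + 1 / 2 by norm_num,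
      Real.rpow_add two_pos, Real.rpow_natCast, Real.sqrt_eq_rpow]
    norm_num
  have hs : Real.sqrt 2 ≠ 0 := by positivity
  have hr := realGamma_quarter_mul_three_quarters
  rw [hp]
  norm_cast
  generalize Real.Gamma (1 / 4) = x at *
  generalize Real.Gamma (3 / 4) = y at *
  generalize Real.Gamma (1 / 2) = z at *
  field_simp
  rw [h2]
  linear_combination -hr

end

theorem mainTheorem7 :
    ∃ f₃₂ : CuspForm
        ((CongruenceSubgroup.Gamma0 32).map (Matrix.SpecialLinearGroup.mapGL ℝ)) 2,
      (∀ τ : UpperHalfPlane,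
        f₃₂ τ = ModularForm.eta (4 * (τ : ℂ)) ^ 2 * ModularForm.eta (8 * (τ : ℂ)) ^ 2) ∧
      ModularForm.L two_pos f₃₂ 1 =
        (((2 : ℝ) ^ (-(7 / 2) : ℝ) : ℝ) : ℂ) * Complex.betaIntegral (1 / 4) (1 / 4) ∧
      ModularForm.L two_pos f₃₂ 1 =
        (((1 / 8 : ℝ) * chowlaSelbergNumber (rationalsAdjoinSqrtNeg 4) : ℝ) : ℂ) := by
  refine ⟨ModularForm.etaCuspForm, fun τ ↦ ?_, ?_, ?_⟩
  · rw [ModularForm.etaCuspForm_apply, ModularForm.etaSqProd]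
    congr 3
    ring
  · rw [ModularForm.L_etaCuspForm_one, betaIntegral_half_quarter_eq]
    ring
  · rw [ModularForm.L_etaCuspForm_one, betaIntegral_half_quarter,
      chowlaSelbergNumber_rationalsAdjoinSqrtNeg_four]
    push_cast
    ring
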